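/- **Theorem (query hierarchy for affine-invariant properties).** Let $\mathrm{RM}(d,n)$ be the set of functions $f:\mathbb F_2^n\to\mathbb F_2$ that are evaluations of polynomials of degree at most $d$. Let $\delta(f,g)$ be the fraction of points of $\mathbb F_2^n$ at which $f$ and $g$ differ, and let $\delta(f,\mathcal P)=\min_{g\in\mathcal P}\delta(f,g)$. A tester for $\mathcal P\subseteq\{\mathbb F_2^n\to\mathbb F_2\}$ with proximity parameter $\delta$ is a randomized (adaptive) oracle algorithm that accepts every $f\in\mathcal P$ with probability at least $2/3$ and rejects every $f$ with $\delta(f,\mathcal P)\ge\delta$ with probability at least $2/3$. It has one-sided error if it accepts every $f\in\mathcal P$ with probability $1$. The property $\mathcal P$ is affine-invariant if $f\circ A\in\mathcal P$ for all $f\in\mathcal P$ and all affine maps $A:\mathbb F_2^n\to\mathbb F_2^n$. There are absolute constants $C>0$ and $\delta_0\in(0,1]$ such that the following holds for every $q:\mathbb N\to\mathbb N$ with $q(n)\ge 1$ for all $n$. Put $\mathcal P_n=\mathrm{RM}(\lceil\log_2 q(n)\rceil,n)$. 1. Every $\mathcal P_n$ is affine-invariant. 2. For every $n$ and every $\delta\in(0,1]$,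 $\mathcal P_n$ has a tester with proximity parameter $\delta$ and one-sided error that makes at most $C\,(q(n)+1/\delta)$ queries. In particular $O(q(n))$ queries suffice for each constant $\delta$, and also for $\delta=\delta(n)=\Omega(1/q(n))$. 3. If $q(n)=O(2^{n/2})$ (in particular, if $q$ is at most linear, $q(n)=O(n)$), then $\mathcal P_n$ is not testable with $o(q(n))$ queries at the constant proximity parameter $\delta_0$, even with two-sided error: for every $Q:\mathbb N\to\mathbb R$ with $Q(n)=o(q(n))$ and all sufficiently large $n$, there is no tester for $\mathcal P_n$ with proximity parameter $\delta_0$ that makes at most $Q(n)$ queries. 4. If $q$ is only at most linear in the size $2^n$ of the domain, namely $q(n)\le 2^n/2$ for all sufficiently large $n$, then $\mathcal P_n$ is not testable with $o(q(n))$ queries, even with two-sided error, at the proximity parameter $\delta(n)=1/(4q(n))$ (for which $O(q(n))$ queries suffice by part 2): for every $Q:\mathbb N\to\mathbb R$ with $Q(n)=o(q(n))$ and all sufficiently large $n$, there is no tester for $\mathcal P_n$ with proximity parameter $1/(4q(n))$ that makes at most $Q(n)$ queries. -/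

import Mathlib

open Filter Asymptotics
open scoped Topology

/-- Functions `𝔽₂ⁿ → 𝔽₂`. -/
abbrev BoolFn (n : ℕ) : Type := (Fin n → ZMod 2) → ZMod 2

/-- The Reed-Muller code `RM(d, n)`: the functions `𝔽₂ⁿ → 𝔽₂` that are evaluations of
polynomials of (total) degree at most `d`. -/
def RM (d n : ℕ) : Set (BoolFn n) :=
  {f | ∃ p : MvPolynomial (Fin n) (ZMod 2), p.totalDegree ≤ d ∧ ∀ x, MvPolynomial.eval x p = f x}

/-- A property of functions on `𝔽₂ⁿ` is affine-invariant if it is closed under composition with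
every (not necessarily invertible) affine map `𝔽₂ⁿ → 𝔽₂ⁿ`. -/
def AffineInvariant {n : ℕ} (P : Set (BoolFn n)) : Prop :=
  ∀ f ∈ P, ∀ A : (Fin n → ZMod 2) →ᵃ[ZMod 2] (Fin n → ZMod 2), (fun x => f (A x)) ∈ P

/-- Fractional Hamming distance: the fraction of the `2 ^ n` points where `f` and `g` differ. -/
noncomputable def relDist {n : ℕ} (f g : BoolFn n) : ℝ :=
  ((Finset.univ.filter fun x => f x ≠ g x).card : ℝ) / 2 ^ n

/-- The distance from `f` to (the nearest element of) `P` is at least `δ`. -/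
def IsFar {n : ℕ} (δ : ℝ) (f : BoolFn n) (P : Set (BoolFn n)) : Prop :=
  ∀ g ∈ P, δ ≤ relDist f g

/-- Deterministic adaptive oracle algorithms for functions `𝔽₂ⁿ → 𝔽₂`. A leaf halts with a
verdict (`true` = accept); `query x t₀ t₁` asks for the value at `x` and continues with `t₀` if the
answer is `0` and with `t₁` if it is `1`. -/
inductive QueryTree (n : ℕ) : Type
  | leaf (verdict : Bool) : QueryTree n
  | query (x : Fin n → ZMod 2) (t₀ t₁ : QueryTree n) : QueryTree n

namespace QueryTree

/-- The verdict of the algorithm when the oracle is `f`. -/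
def run {n : ℕ} (f : BoolFn n) : QueryTree n → Bool
  | leaf b => b
  | query x t₀ t₁ => if f x = 0 then t₀.run f else t₁.run f

/-- The worst-case number of queries. -/
def depth {n : ℕ} : QueryTree n → ℕ
  | leaf _ => 0
  | query _ t₀ t₁ => max t₀.depth t₁.depth + 1

end QueryTree

/-- A randomized oracle algorithm: a probability distribution on deterministic ones. -/
abbrev RandAlg (n : ℕ) : Type := PMF (QueryTree n)

/-- The probability that the randomized algorithm `T` gives the verdict `b` on the oracle `f`. -/
noncomputable def RandAlg.prob {n : ℕ} (T : RandAlg n) (f : BoolFn n) (b : Bool) : ENNReal :=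
  (T.map (QueryTree.run f)) b

/-- `T` makes at most `Q` queries, whatever its coin tosses and the oracle. -/
def RandAlg.QueriesAtMost {n : ℕ} (T : RandAlg n) (Q : ℝ) : Prop :=
  ∀ t ∈ T.support, (t.depth : ℝ) ≤ Q

/-- `P` has a tester with one-sided error for the proximity parameter `δ` that makes at most `Q`
queries: members of `P` are accepted with probability `1`, functions at distance at least `δ` from
`P` are rejected with probability at least `2/3`. -/
def OneSidedTestable {n : ℕ} (P : Set (BoolFn n)) (δ Q : ℝ) : Prop :=
  ∃ T : RandAlg n, T.QueriesAtMost Q ∧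
    (∀ f ∈ P, T.prob f true = 1) ∧ (∀ f, IsFar δ f P → 2 / 3 ≤ T.prob f false)

/-- The same with two-sided error: members of `P` are only required to be accepted with
probability at least `2/3`. -/
def TwoSidedTestable {n : ℕ} (P : Set (BoolFn n)) (δ Q : ℝ) : Prop :=
  ∃ T : RandAlg n, T.QueriesAtMost Q ∧
    (∀ f ∈ P, 2 / 3 ≤ T.prob f true) ∧ (∀ f, IsFar δ f P → 2 / 3 ≤ T.prob f false)

/-- The ensemble of properties `RM(⌈log₂ q(n)⌉, n)`, one for every number `n` of variables. -/
def RMHier (q : ℕ → ℕ) (n : ℕ) : Set (BoolFn n) :=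
  RM (Nat.clog 2 (q n)) n

/-! Put d = ⌈log₂ q⌉, so that q ≤ 2^d ≤ 2q; the theorem is then about RM(d, n), with 2^d in the role
of q.

Lower bounds: functions of degree at most d take arbitrary values at any 2^d points
(`exists_degLE_interpolate`). So for a fixed h, an adaptive algorithm with at most 2^d queries
cannot tell a uniformly random codeword c from c + h (`card_run_translate`), although c + h is
exactly as far from the code as h. Any far h therefore rules out a tester. The indicator of a
subcube of codimension d + 1 has distance at least 2^-(d+1) ≥ 1/(4q); if d ≤ n/2 + O(1), a volume
count gives an h at constant distance.

Upper bound: restrict f to a random flat of dimension d + 6 and read it completely. Codewords always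
pass, and a function at distance δ is rejected with probability at least min(2^d δ, 1/32)
(`flatRej_ge_min`), so O(1 + 1/(2^d δ)) repetitions of 2^(d+6) queries suffice. Two regimes give
this bound. Near the code, the number of errors on the flat is controlled by its first two moments
(`flatRej_ge_quadratic`). Far from the code, induct on the dimension through random hyperplanes: if
f is close to degree d on at least 8 * 2^d hyperplanes, the local codewords are consistent and glue
to a global one, so f is not too far and the first regime applies (`exists_close_of_close_on_hyps`).
Otherwise few hyperplanes are bad, and the losses over all dimensions form a geometric series
(`flatRej_ge_of_far`). -/

/-- The points of `𝔽₂ⁿ`. -/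
abbrev Cube (n : ℕ) : Type := Fin n → ZMod 2

theorem zmod_two_cases (z : ZMod 2) : z = 0 ∨ z = 1 := by
  revert z; decide

theorem zmod_two_add_self (z : ZMod 2) : z + z = 0 := by
  revert z; decide

/-! ### Affine functionals and a coordinate-free notion of degree -/

/-- Affine functionals on the cube. -/
def IsAff {n : ℕ} (l : BoolFn n) : Prop :=
  ∃ (a : Cube n) (b : ZMod 2), ∀ x, l x = dotProduct a x + b

/-- Maps between cubes all of whose coordinates are affine functionals. -/
def IsAffMap {n m : ℕ} (φ : Cube n → Cube m) : Prop :=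
  ∀ i, IsAff fun x => φ x i

theorem IsAff.const {n : ℕ} (c : ZMod 2) : IsAff (fun _ : Cube n => c) :=
  ⟨0, c, by simp⟩

theorem IsAff.add {n : ℕ} {l l' : BoolFn n} (h : IsAff l) (h' : IsAff l') :
    IsAff (fun x => l x + l' x) := by
  obtain ⟨a, b, h⟩ := h
  obtain ⟨a', b', h'⟩ := h'
  exact ⟨a + a', b + b', fun x => by simp only [h, h', add_dotProduct]; ring⟩

theorem IsAff.const_mul {n : ℕ} {l : BoolFn n} (c : ZMod 2) (h : IsAff l) :
    IsAff (fun x => c * l x) := by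
  obtain ⟨a, b, h⟩ := h
  exact ⟨c • a, c * b, fun x => by simp only [h, smul_dotProduct, smul_eq_mul]; ring⟩

theorem IsAff.sum {n : ℕ} {ι : Type*} (s : Finset ι) {l : ι → BoolFn n}
    (h : ∀ i ∈ s, IsAff (l i)) : IsAff (fun x => ∑ i ∈ s, l i x) := by
  classical
  induction s using Finset.induction_on with
  | empty => simpa using IsAff.const 0
  | insert i s hi ih =>
    simp only [Finset.sum_insert hi]
    exact (h i (by simp)).add (ih fun j hj => h j (by simp [hj]))

theorem IsAff.coord {n : ℕ} (i : Fin n) : IsAff (fun x : Cube n => x i) :=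
  ⟨Pi.single i 1, 0, fun x => by simp⟩

theorem isAff_dotProduct_add {n : ℕ} (a : Cube n) (b : ZMod 2) :
    IsAff (fun x => dotProduct a x + b) :=
  ⟨a, b, fun _ => rfl⟩

theorem IsAff.comp {n m : ℕ} {l : BoolFn m} {φ : Cube n → Cube m} (h : IsAff l)
    (hφ : IsAffMap φ) : IsAff (fun x => l (φ x)) := by
  obtain ⟨a, b, h⟩ := h
  simp only [h, dotProduct]
  exact (IsAff.sum _ fun i _ => (hφ i).const_mul _).add (IsAff.const b)

theorem isAffMap_affineMap {n m : ℕ} (A : Cube n →ᵃ[ZMod 2] Cube m) : IsAffMap A := by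
  intro i
  have h : (fun x => A x i) = fun x => (∑ j, (A.linear (Pi.single j 1) i) * x j) + A 0 i := by
    funext x
    have h1 : A x = A.linear x + A 0 := by
      have := A.map_vadd 0 x
      simpa using this
    have h2 : A.linear x = ∑ j, x j • A.linear (Pi.single j 1) := by
      conv_lhs => rw [pi_eq_sum_univ' x]
      simp [map_sum]
    rw [h1, h2]
    simp [Finset.sum_apply, mul_comm]
  rw [h]
  exact (IsAff.sum _ fun j _ => (IsAff.coord j).const_mul _).add (IsAff.const _)

/-- `DegLE d f`: the function `f` is a sum of products of at most `d` affine functionals. -/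
inductive DegLE {n : ℕ} : ℕ → BoolFn n → Prop
  | const (d : ℕ) (c : ZMod 2) : DegLE d (fun _ => c)
  | add {d : ℕ} {f g : BoolFn n} : DegLE d f → DegLE d g → DegLE d (fun x => f x + g x)
  | mul {d : ℕ} {l f : BoolFn n} : IsAff l → DegLE d f → DegLE (d + 1) (fun x => l x * f x)

namespace DegLE

variable {n : ℕ}

theorem succ {d : ℕ} {f : BoolFn n} (h : DegLE d f) : DegLE (d + 1) f := by
  simpa using h.mul (IsAff.const 1)

theorem mono {d e : ℕ} {f : BoolFn n} (h : DegLE d f) (hde : d ≤ e) : DegLE e f := by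
  induction hde with
  | refl => exact h
  | step _ ih => exact ih.succ

theorem sum {d : ℕ} {ι : Type*} (s : Finset ι) {f : ι → BoolFn n}
    (h : ∀ i ∈ s, DegLE d (f i)) : DegLE d (fun x => ∑ i ∈ s, f i x) := by
  classical
  induction s using Finset.induction_on with
  | empty => simpa using DegLE.const d 0
  | insert i s hi ih =>
    simp only [Finset.sum_insert hi]
    exact (h i (by simp)).add (ih fun j hj => h j (by simp [hj]))

theorem comp {m d : ℕ} {f : BoolFn m} (h : DegLE d f) {φ : Cube n → Cube m}
    (hφ : IsAffMap φ) : DegLE d (fun x => f (φ x)) := by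
  induction h with
  | const d c => exact .const d c
  | add _ _ ih ih' => exact ih.add ih'
  | mul hl _ ih => exact ih.mul (hl.comp hφ)

theorem const_mul {d : ℕ} {f : BoolFn n} (h : DegLE d f) (c : ZMod 2) :
    DegLE d (fun x => c * f x) := by
  rcases zmod_two_cases c with rfl | rfl
  · simpa using DegLE.const d 0
  · simpa using h

theorem eq_const {d : ℕ} {f : BoolFn n} (h : DegLE d f) (hd : d = 0) : ∃ c, ∀ x, f x = c := by
  induction h with
  | const d c => exact ⟨c, fun _ => rfl⟩
  | add _ _ ih ih' =>
    obtain ⟨c, hc⟩ := ih hd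
    obtain ⟨c', hc'⟩ := ih' hd
    exact ⟨c + c', fun x => by simp only [hc, hc']⟩
  | mul => omega

theorem shift {d : ℕ} {f : BoolFn n} (h : DegLE d f) (v : Cube n) :
    DegLE d (fun x => f (x + v)) :=
  h.comp fun i => (IsAff.coord i).add (IsAff.const (v i))

/-- Product rule: a shift changes an affine factor only by a constant, so each term loses a factor.
The truncated `d - 1` is harmless, since derivatives of constants vanish. -/
theorem derivative {d : ℕ} {f : BoolFn n} (h : DegLE d f) (v : Cube n) :
    DegLE (d - 1) (fun x => f (x + v) + f x) := by
  induction h with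
  | const d c => simpa [zmod_two_add_self] using DegLE.const (d - 1) 0
  | add _ _ ih ih' =>
    convert ih.add ih' using 2
    ring
  | @mul d l f hl hf ih =>
    obtain ⟨a, b, hab⟩ := id hl
    have key : (fun x => l (x + v) * f (x + v) + l x * f x) =
        fun x => l x * (f (x + v) + f x) + dotProduct a v * f (x + v) := by
      funext x
      rw [hab, hab, dotProduct_add]
      ring
    rw [key, Nat.add_sub_cancel]
    refine DegLE.add ?_ ((hf.shift v).const_mul _)
    rcases d with _ | d
    · obtain ⟨c, hc⟩ := hf.eq_const rfl
      simpa [hc, zmod_two_add_self] using DegLE.const 0 0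
    · exact ih.mul hl

end DegLE

/-! ### Minimum distance -/

/-- The points at which `f` does not vanish. -/
def fnSupport {n : ℕ} (f : BoolFn n) : Finset (Cube n) :=
  Finset.univ.filter fun x => f x ≠ 0

theorem mem_fnSupport {n : ℕ} {f : BoolFn n} {x : Cube n} : x ∈ fnSupport f ↔ f x ≠ 0 := by
  simp [fnSupport]

theorem card_cube (n : ℕ) : Fintype.card (Cube n) = 2 ^ n := by
  simp [ZMod.card]

/-- The minimum distance of the Reed-Muller code. -/
theorem DegLE.two_pow_le {n d : ℕ} {f : BoolFn n} (h : DegLE d f) (hf : ∃ x, f x ≠ 0) :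
    2 ^ n ≤ 2 ^ d * (fnSupport f).card := by
  induction d generalizing f with
  | zero =>
    obtain ⟨c, hc⟩ := h.eq_const rfl
    obtain ⟨x, hx⟩ := hf
    have : fnSupport f = Finset.univ := by
      ext y
      simp [mem_fnSupport, hc y, ← hc x, hx]
    rw [this, Finset.card_univ, card_cube]
    simp
  | succ d ih =>
    -- A nonzero derivative has lower degree and at most twice the support of `f`; if all
    -- derivatives vanish, `f` is a nonzero constant.
    by_cases hD : ∃ v x, f (x + v) + f x ≠ 0
    · obtain ⟨v, hv⟩ := hD
      have h1 := ih (h.derivative v) hv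
      have h2 : (fnSupport fun x => f (x + v) + f x).card ≤ 2 * (fnSupport f).card := by
        have hsub : (fnSupport fun x => f (x + v) + f x) ⊆
            fnSupport f ∪ (fnSupport f).image (fun x => x - v) := by
          intro x hx
          rw [mem_fnSupport] at hx
          rw [Finset.mem_union, Finset.mem_image]
          by_cases hx0 : f x = 0
          · right
            refine ⟨x + v, ?_, by simp⟩
            rw [mem_fnSupport]
            simpa [hx0] using hx
          · left
            rwa [mem_fnSupport]
        have h3 := (Finset.card_le_card hsub).trans (Finset.card_union_le _ _)
        rw [two_mul]
        exact h3.trans (Nat.add_le_add_left Finset.card_image_le _)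
      calc 2 ^ n ≤ 2 ^ d * _ := h1
        _ ≤ 2 ^ d * (2 * (fnSupport f).card) := by gcongr
        _ = _ := by ring
    · push Not at hD
      obtain ⟨x, hx⟩ := hf
      have : fnSupport f = Finset.univ := by
        ext y
        have h0 := hD (y - x) x
        have h1 : f y + f x = 0 := by simpa using h0
        simp only [mem_fnSupport, Finset.mem_univ, iff_true]
        intro hy
        apply hx
        simpa [hy] using h1
      rw [this, Finset.card_univ, card_cube]
      exact Nat.le_mul_of_pos_left _ (by positivity)

/-! ### Interpolation at `2 ^ d` points -/

theorem exists_dotProduct_eq_one {n : ℕ} {a : Cube n} (ha : a ≠ 0) :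
    ∃ v : Cube n, dotProduct a v = 1 := by
  obtain ⟨i, hi⟩ := Function.ne_iff.1 ha
  exact ⟨Pi.single i 1, by simpa using (zmod_two_cases (a i)).resolve_left hi⟩

/-- Exactly half of the cube is annihilated by a nonzero linear functional. -/
theorem two_mul_card_filter_dotProduct {n : ℕ} {a : Cube n} (ha : a ≠ 0) (c : ZMod 2) :
    2 * (Finset.univ.filter fun x : Cube n => dotProduct x a = c).card = 2 ^ n := by
  obtain ⟨v, hv⟩ := exists_dotProduct_eq_one ha
  have hcard : (Finset.univ.filter fun x : Cube n => dotProduct x a = c).card =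
      (Finset.univ.filter fun x : Cube n => ¬ dotProduct x a = c).card := by
    refine Finset.card_bij' (fun x _ => x + v) (fun x _ => x - v) ?_ ?_ ?_ ?_
    · intro x hx
      simp only [Finset.mem_filter, Finset.mem_univ, true_and] at hx ⊢
      rw [add_dotProduct, hx, dotProduct_comm v, hv]
      simp
    · intro x hx
      simp only [Finset.mem_filter, Finset.mem_univ, true_and] at hx ⊢
      rw [sub_dotProduct, dotProduct_comm v, hv]
      revert hx
      generalize dotProduct x a = z
      revert z c
      decide
    · intro x _; simp
    · intro x _; simp
  have h := Finset.card_filter_add_card_filter_not (s := (Finset.univ : Finset (Cube n)))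
    (fun x => dotProduct x a = c)
  rw [Finset.card_univ, card_cube] at h
  omega

/-- Some affine functional that is `1` at `s` kills at least half of `T`. -/
theorem exists_isAff_kill_half {n : ℕ} (s : Cube n) (T : Finset (Cube n)) (hs : s ∉ T) :
    ∃ l : BoolFn n, IsAff l ∧ l s = 1 ∧ 2 * (T.filter fun t => l t ≠ 0).card ≤ T.card := by
  by_contra! hcon
  have hlt : ∀ a : Cube n, T.card < 2 * (T.filter fun t => dotProduct a (t - s) = 0).card := by
    intro a
    -- Normalized to be 1 at `s`, this functional is nonzero at `t` exactly when `a` annihilates `t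
    -- - s`. For fixed `t ≠ s` half of all `a` do so, hence some `a` is at least as good as the
    -- average.
    have := hcon (fun x => dotProduct a (x - s) + 1)
      ⟨a, 1 - dotProduct a s, fun x => by simp only [dotProduct_sub]; ring⟩ (by simp)
    have hz : ∀ z : ZMod 2, z + 1 ≠ 0 ↔ z = 0 := by decide
    simpa only [hz] using this
  have hsum : ∑ a : Cube n, 2 * (T.filter fun t => dotProduct a (t - s) = 0).card =
      ∑ t ∈ T, 2 ^ n := by
    rw [← Finset.mul_sum]
    simp only [Finset.card_filter]
    rw [Finset.sum_comm, Finset.mul_sum]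
    refine Finset.sum_congr rfl fun t ht => ?_
    rw [← Finset.card_filter]
    refine two_mul_card_filter_dotProduct (sub_ne_zero.2 ?_) 0
    rintro rfl
    exact hs ht
  have h2 : ∑ _a : Cube n, T.card < ∑ a : Cube n,
      2 * (T.filter fun t => dotProduct a (t - s) = 0).card :=
    Finset.sum_lt_sum_of_nonempty Finset.univ_nonempty fun a _ => hlt a
  rw [hsum, Finset.sum_const, Finset.sum_const, Finset.card_univ, card_cube] at h2
  simp [mul_comm] at h2

theorem exists_degLE_indicator {n : ℕ} (d : ℕ) (s : Cube n) (T : Finset (Cube n)) (hs : s ∉ T)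
    (hT : T.card < 2 ^ d) : ∃ f : BoolFn n, DegLE d f ∧ f s = 1 ∧ ∀ t ∈ T, f t = 0 := by
  induction d generalizing T with
  | zero =>
    refine ⟨fun _ => 1, .const 0 1, rfl, ?_⟩
    have : T = ∅ := by simpa using hT
    simp [this]
  | succ d ih =>
    -- Each affine factor costs one degree and halves the set still to be killed.
    obtain ⟨l, hl, hls, hlT⟩ := exists_isAff_kill_half s T hs
    obtain ⟨f, hf, hfs, hfT⟩ := ih (T.filter fun t => l t ≠ 0) (by simp [hs])
      (by
      rw [pow_succ, mul_comm] at hT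
      exact Nat.lt_of_mul_lt_mul_left (lt_of_le_of_lt hlT hT))
    refine ⟨_, hf.mul hl, by simp [hls, hfs], fun t ht => ?_⟩
    by_cases hlt : l t = 0
    · simp [hlt]
    · simp [hfT t (by simp [ht, hlt])]

/-- Functions of degree at most `d` interpolate arbitrary values at any `2 ^ d` points. -/
theorem exists_degLE_interpolate {n : ℕ} (d : ℕ) (S : Finset (Cube n)) (hS : S.card ≤ 2 ^ d)
    (h : BoolFn n) : ∃ f : BoolFn n, DegLE d f ∧ ∀ s ∈ S, f s = h s := by
  have hind : ∀ s, ∃ f : BoolFn n, s ∈ S → DegLE d f ∧ f s = 1 ∧ ∀ t ∈ S.erase s, f t = 0 := by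
    intro s
    by_cases hs : s ∈ S
    · obtain ⟨f, hf⟩ := exists_degLE_indicator d s (S.erase s) (by simp)
        (lt_of_lt_of_le (Finset.card_erase_lt_of_mem hs) hS)
      exact ⟨f, fun _ => hf⟩
    · exact ⟨0, fun h => absurd h hs⟩
  choose F hF using hind
  refine ⟨_, DegLE.sum S fun s hs => (hF s hs).1.const_mul (h s), fun s hs => ?_⟩
  rw [Finset.sum_eq_single s]
  · rw [(hF s hs).2.1, mul_one]
  · intro t ht hts
    rw [(hF t ht).2.2 s (by simp [hs, hts.symm]), mul_zero]
  · exact fun h => absurd hs h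

theorem degLE_dim {n : ℕ} (h : BoolFn n) : DegLE n h := by
  obtain ⟨f, hf, hfh⟩ := exists_degLE_interpolate n Finset.univ
    (by rw [Finset.card_univ, card_cube]) h
  rwa [show h = f from funext fun x => (hfh x (Finset.mem_univ x)).symm]

theorem degLE_multiset_prod {n : ℕ} (s : Multiset (Fin n)) :
    DegLE s.card (fun x : Cube n => (s.map x).prod) := by
  induction s using Multiset.induction_on with
  | empty => simpa using DegLE.const 0 1
  | cons i s ih => simpa using ih.mul (IsAff.coord i)

/-- Passing to products of affine functionals makes composition with affine maps and differentiation
immediate; polynomials return only for counting monomials. -/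
theorem mem_RM_iff {n d : ℕ} {f : BoolFn n} : f ∈ RM d n ↔ DegLE d f := by
  constructor
  · rintro ⟨p, hp, hf⟩
    have hsum : f = fun x => ∑ s ∈ p.support, p.coeff s * (s.toMultiset.map x).prod := by
      funext x
      rw [← hf, MvPolynomial.eval_eq]
      refine Finset.sum_congr rfl fun s _ => ?_
      rw [Finsupp.toMultiset_map, Finsupp.prod_toMultiset, Finsupp.prod_mapDomain_index]
      · rfl
      · simp
      · intros; rw [pow_add]
    rw [hsum]
    refine DegLE.sum _ fun s hs => DegLE.const_mul ((degLE_multiset_prod s.toMultiset).mono ?_) _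
    rw [Finsupp.card_toMultiset]
    exact (MvPolynomial.le_totalDegree hs).trans hp
  · intro h
    induction h with
    | const d c => exact ⟨MvPolynomial.C c, by simp, by simp⟩
    | add _ _ ih ih' =>
      obtain ⟨p, hp, hf⟩ := ih
      obtain ⟨p', hp', hf'⟩ := ih'
      exact ⟨p + p', (MvPolynomial.totalDegree_add _ _).trans (max_le hp hp'),
        fun x => by simp [hf, hf']⟩
    | mul hl _ ih =>
      obtain ⟨a, b, hl⟩ := hl
      obtain ⟨p, hp, hf⟩ := ih
      refine ⟨(∑ i, MvPolynomial.C (a i) * MvPolynomial.X i + MvPolynomial.C b) * p, ?_,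
        fun x => by simp [hf, hl, dotProduct]⟩
      refine (MvPolynomial.totalDegree_mul _ _).trans ?_
      rw [add_comm]
      refine Nat.add_le_add hp ((MvPolynomial.totalDegree_add _ _).trans (max_le ?_ (by simp)))
      refine MvPolynomial.totalDegree_finsetSum_le fun i _ => ?_
      refine (MvPolynomial.totalDegree_mul _ _).trans ?_
      simp

theorem affineInvariant_RM (d n : ℕ) : AffineInvariant (RM d n) := by
  intro f hf A
  rw [mem_RM_iff] at hf ⊢
  exact hf.comp (isAffMap_affineMap A)

/-! ### Indistinguishability and the query lower bound -/

/-- On few queries, uniformly random functions of degree at most `d` are indistinguishable from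
their translates by a fixed function `h`. -/
theorem card_run_translate {n d : ℕ} (h : BoolFn n) (b : Bool) (t : QueryTree n)
    (S : Finset (Cube n)) (α : BoolFn n) (hS : S.card + t.depth ≤ 2 ^ d) :
    Set.ncard {c : BoolFn n | DegLE d c ∧ (∀ s ∈ S, c s = α s) ∧ t.run c = b} =
      Set.ncard {c : BoolFn n | DegLE d c ∧ (∀ s ∈ S, c s + h s = α s) ∧
        t.run (fun x => c x + h x) = b} := by
  classical
  induction t generalizing S α with
  | leaf v =>
    -- `S` and `α` record the queries answered so far. At a leaf, adding a codeword `u` that agrees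
    -- with `h` on `S` is a bijection between the two sets.
    obtain ⟨u, hu, huS⟩ := exists_degLE_interpolate d S (by simpa [QueryTree.depth] using hS) h
    refine Set.ncard_congr (fun c _ => fun x => c x + u x) ?_ ?_ ?_
    · rintro c ⟨hc, hcS, hr⟩
      refine ⟨hc.add hu, fun s hs => ?_, hr⟩
      simp only [huS s hs, add_assoc, zmod_two_add_self, add_zero, hcS s hs]
    · intro c c' _ _ hcc
      funext x
      exact add_right_cancel (congrFun hcc x)
    · rintro c ⟨hc, hcS, hr⟩
      refine ⟨fun x => c x + u x, ⟨hc.add hu, fun s hs => ?_, hr⟩, ?_⟩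
      · simp only [huS s hs, hcS s hs]
      · funext x
        simp only [add_assoc, zmod_two_add_self, add_zero]
  | query x t₀ t₁ ih₀ ih₁ =>
    simp only [QueryTree.depth] at hS
    have hcard : (insert x S).card ≤ S.card + 1 := Finset.card_insert_le x S
    by_cases hx : x ∈ S
    · by_cases h0 : α x = 0
      · have := ih₀ S α (by have := le_max_left t₀.depth t₁.depth; omega)
        convert this using 3
        · refine funext fun c => propext (and_congr_right fun _ => and_congr_right fun hc => ?_)
          simp [QueryTree.run, hc x hx, h0]
        · refine funext fun c => propext (and_congr_right fun _ => and_congr_right fun hc => ?_)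
          simp [QueryTree.run, hc x hx, h0]
      · have := ih₁ S α (by have := le_max_right t₀.depth t₁.depth; omega)
        convert this using 3
        · refine funext fun c => propext (and_congr_right fun _ => and_congr_right fun hc => ?_)
          simp [QueryTree.run, hc x hx, h0]
        · refine funext fun c => propext (and_congr_right fun _ => and_congr_right fun hc => ?_)
          simp [QueryTree.run, hc x hx, h0]
    -- A new point: split by its answer and record it. This raises `S.card` by one and lowers the
    -- depth, so the budget `2 ^ d` is kept.
    · have key : ∀ (c : BoolFn n) (z : ZMod 2),
          (∀ s ∈ insert x S, c s = Function.update α x z s) ↔ c x = z ∧ ∀ s ∈ S, c s = α s := by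
        intro c z
        rw [Finset.forall_mem_insert, Function.update_self]
        refine and_congr_right fun _ => forall₂_congr fun s hs => ?_
        rw [Function.update_of_ne]
        rintro rfl
        exact hx hs
      have e₀ := ih₀ (insert x S) (Function.update α x 0)
        (by have := le_max_left t₀.depth t₁.depth; omega)
      have e₁ := ih₁ (insert x S) (Function.update α x 1)
        (by have := le_max_right t₀.depth t₁.depth; omega)
      have split : ∀ g : BoolFn n → BoolFn n,
          Set.ncard {c : BoolFn n | DegLE d c ∧ (∀ s ∈ S, g c s = α s) ∧
            (QueryTree.query x t₀ t₁).run (g c) = b} =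
          Set.ncard {c : BoolFn n | DegLE d c ∧
            (∀ s ∈ insert x S, g c s = Function.update α x 0 s) ∧ t₀.run (g c) = b} +
          Set.ncard {c : BoolFn n | DegLE d c ∧
            (∀ s ∈ insert x S, g c s = Function.update α x 1 s) ∧ t₁.run (g c) = b} := by
        intro g
        rw [← Set.ncard_union_eq]
        · congr 1
          ext c
          simp only [Set.mem_ofPred_eq, Set.mem_union, key, QueryTree.run]
          rcases zmod_two_cases (g c x) with hz | hz <;> simp [hz]
        · rw [Set.disjoint_left]
          rintro c ⟨_, h1, _⟩ ⟨_, h2, _⟩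
          have h3 := ((key _ _).1 h1).1.symm.trans ((key _ _).1 h2).1
          exact zero_ne_one h3
      have s1 := split id
      have s2 := split fun c x => c x + h x
      simp only [id] at s1
      rw [s1, s2, e₀, e₁]

theorem RandAlg.prob_eq_tsum {n : ℕ} (T : RandAlg n) (f : BoolFn n) (b : Bool) :
    T.prob f b = ∑' t, if t.run f = b then T t else 0 := by
  rw [RandAlg.prob, PMF.map_apply]
  refine tsum_congr fun t => ?_
  by_cases h : t.run f = b
  · rw [if_pos h, if_pos h.symm]
  · rw [if_neg h, if_neg (Ne.symm h)]

theorem RandAlg.prob_true_add_prob_false {n : ℕ} (T : RandAlg n) (f : BoolFn n) :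
    T.prob f true + T.prob f false = 1 := by
  have := (T.map (QueryTree.run f)).tsum_coe
  rwa [tsum_bool, add_comm] at this

/-- A function far from `RM(d, n)` defeats all testers with at most `2 ^ d` queries. -/
theorem not_twoSidedTestable_RM {n d : ℕ} {δ Q : ℝ} (hQ : Q ≤ 2 ^ d) {h : BoolFn n}
    (hfar : IsFar δ h (RM d n)) : ¬ TwoSidedTestable (RM d n) δ Q := by
  classical
  rintro ⟨T, hT, hacc, hrej⟩
  let V : Finset (BoolFn n) := Finset.univ.filter fun c => DegLE d c
  -- Averaged over all codewords, the acceptance probability is unchanged by translation, yet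
  -- testing would force at least 2/3 on one side and at most 1/3 on the other.
  have hsum : ∑ c ∈ V, T.prob c true = ∑ c ∈ V, T.prob (fun x => c x + h x) true := by
    simp only [RandAlg.prob_eq_tsum]
    rw [← Summable.tsum_finsetSum fun _ _ => ENNReal.summable,
      ← Summable.tsum_finsetSum fun _ _ => ENNReal.summable]
    refine tsum_congr fun t => ?_
    by_cases ht : T t = 0
    · simp [ht]
    · have hdepth : t.depth ≤ 2 ^ d := by
        have := (hT t (by rwa [PMF.mem_support_iff])).trans hQ
        exact_mod_cast this
      have := card_run_translate (d := d) h true t ∅ 0 (by simpa using hdepth)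
      rw [← Finset.sum_filter, ← Finset.sum_filter, Finset.sum_const, Finset.sum_const]
      congr 1
      rw [Set.ncard_eq_toFinset_card', Set.ncard_eq_toFinset_card'] at this
      convert this using 2
      · ext c; simp [V]
      · ext c; simp [V]
  have h1 : ∀ c ∈ V, (2 / 3 : ENNReal) ≤ T.prob c true := fun c hc =>
    hacc c (mem_RM_iff.2 (by simpa [V] using hc))
  have h2 : ∀ c ∈ V, T.prob (fun x => c x + h x) true ≤ 1 / 3 := by
    intro c hc
    have hc' : DegLE d c := by simpa [V] using hc
    have hf := hrej (fun x => c x + h x) (by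
      intro g hg
      rw [mem_RM_iff] at hg
      refine (hfar (fun x => g x + c x) (mem_RM_iff.2 (hg.add hc'))).trans (le_of_eq ?_)
      unfold relDist
      congr 3
      ext x
      simp only [Finset.mem_filter, Finset.mem_univ, true_and]
      generalize h x = z, g x = z', c x = z''
      revert z z' z''
      decide)
    have hadd := T.prob_true_add_prob_false (fun x => c x + h x)
    by_contra hcon
    push Not at hcon
    have : (1 : ENNReal) < 1 := by
      calc (1 : ENNReal) = 1 / 3 + 2 / 3 := by
            rw [ENNReal.div_add_div_same]; norm_num
            exact (ENNReal.div_self (by norm_num) (by norm_num)).symm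
        _ < T.prob (fun x => c x + h x) true + T.prob (fun x => c x + h x) false :=
          ENNReal.add_lt_add_of_lt_of_le (by simp [ENNReal.div_eq_top]) hcon hf
        _ = 1 := hadd
    exact lt_irrefl _ this
  have hV : V.Nonempty := ⟨fun _ => 0, by simpa [V] using DegLE.const d 0⟩
  have h3 := (Finset.sum_le_sum h1).trans (hsum.le.trans (Finset.sum_le_sum h2))
  rw [Finset.sum_const, Finset.sum_const, nsmul_eq_mul, nsmul_eq_mul] at h3
  have hne : (V.card : ENNReal) ≠ 0 := by simpa using hV.ne_empty
  have h4 := (ENNReal.mul_le_mul_iff_right hne (ENNReal.natCast_ne_top _)).1 h3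
  have h5 : (1 / 3 : ENNReal) < 2 / 3 := by
    rw [ENNReal.div_lt_div_iff_left] <;> norm_num
  exact absurd h4 (not_le.2 h5)

/-! ### Functions far from the code -/

/-- A function of degree `d + 1` at distance `2 ^ (-(d + 1))` from `RM(d, n)`. -/
theorem exists_isFar_two_pow {n d : ℕ} (hd : d + 1 ≤ n) :
    ∃ h : BoolFn n, IsFar (1 / 2 ^ (d + 1)) h (RM d n) := by
  classical
  let e : BoolFn (d + 1) := fun y => if y = 0 then 1 else 0
  let ψ : Cube n → Cube (d + 1) := fun x i => x (Fin.castLE hd i)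
  let φ : Cube (d + 1) → Cube n := fun y i => if hi : (i : ℕ) < d + 1 then y ⟨i, hi⟩ else 0
  have hψ : IsAffMap ψ := fun i => IsAff.coord _
  have hφ : IsAffMap φ := by
    intro i
    by_cases hi : (i : ℕ) < d + 1
    · simp only [φ, dif_pos hi]
      exact IsAff.coord _
    · simp only [φ, dif_neg hi]
      exact IsAff.const 0
  have hψφ : ∀ y, ψ (φ y) = y := by
    intro y
    funext i
    simp only [ψ, φ, Fin.val_castLE, i.isLt, dif_pos]
  have hdeg : DegLE (d + 1) fun x => e (ψ x) := (degLE_dim e).comp hψ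
  have hnot : ¬ DegLE d fun x => e (ψ x) := by
    intro hcon
    have h1 := (hcon.comp hφ).two_pow_le ⟨0, by simp [hψφ, e]⟩
    have h2 : (fnSupport fun y => e (ψ (φ y))) = {0} := by
      ext y
      simp [mem_fnSupport, hψφ, e]
    rw [h2, Finset.card_singleton, pow_succ] at h1
    have := Nat.pow_pos (n := d) (show 0 < 2 by norm_num)
    omega
  refine ⟨fun x => e (ψ x), fun g hg => ?_⟩
  rw [mem_RM_iff] at hg
  have hne : ∃ x, e (ψ x) + g x ≠ 0 := by
    by_contra! hcon
    refine hnot ?_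
    convert hg using 2 with x
    exact CharTwo.add_eq_zero.1 (hcon x)
  -- The difference has degree at most `d + 1` and is nonzero, so the minimum distance of RM(d + 1,
  -- n) applies.
  have h1 := (hdeg.add hg.succ).two_pow_le hne
  have h2 : (fnSupport fun x => e (ψ x) + g x) =
      Finset.univ.filter fun x => e (ψ x) ≠ g x := by
    ext x
    simp [mem_fnSupport, CharTwo.add_eq_zero]
  rw [h2] at h1
  unfold relDist
  rw [div_le_div_iff₀ (by positivity) (by positivity), one_mul, mul_comm]
  exact_mod_cast h1

theorem natCard_span_le_two_pow {M : Type*} [AddCommGroup M] [Module (ZMod 2) M] (s : Finset M) :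
    Nat.card (Submodule.span (ZMod 2) (s : Set M)) ≤ 2 ^ s.card := by
  have : Module.Finite (ZMod 2) (Submodule.span (ZMod 2) (s : Set M)) :=
    Module.Finite.span_finset _ s
  rw [Module.natCard_eq_pow_finrank (K := ZMod 2), Nat.card_zmod]
  exact Nat.pow_le_pow_right (by norm_num) (finrank_span_finset_le_card s)

/-- The bound 4^m / √(2m + 1) on the central binomial coefficient, free of square roots; it shows
that boundedly many middle layers form a small part of the cube. -/
theorem two_mul_add_one_mul_centralBinom_sq_le (m : ℕ) :
    (2 * m + 1) * m.centralBinom ^ 2 ≤ 16 ^ m := by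
  induction m with
  | zero => simp
  | succ m ih =>
    have h := Nat.succ_mul_centralBinom_succ m
    have h2 : (m + 1) ^ 2 * ((2 * (m + 1) + 1) * (m + 1).centralBinom ^ 2) ≤
        (m + 1) ^ 2 * 16 ^ (m + 1) := by
      calc (m + 1) ^ 2 * ((2 * (m + 1) + 1) * (m + 1).centralBinom ^ 2)
          = (2 * m + 3) * ((m + 1) * (m + 1).centralBinom) ^ 2 := by ring
        _ = 4 * ((2 * m + 3) * (2 * m + 1)) * ((2 * m + 1) * m.centralBinom ^ 2) := by
          rw [h]; ring
        _ ≤ 4 * (4 * (m + 1) ^ 2) * 16 ^ m :=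
          Nat.mul_le_mul (Nat.mul_le_mul_left 4 (by nlinarith)) ih
        _ = _ := by ring
    exact Nat.le_of_mul_le_mul_left h2 (by positivity)

theorem choose_le_two_mul_centralBinom_half (n r : ℕ) :
    n.choose r ≤ 2 * (n / 2).centralBinom := by
  rcases Nat.even_or_odd' n with ⟨m, rfl | rfl⟩
  · rw [Nat.mul_div_cancel_left _ (by norm_num)]
    have := Nat.choose_le_centralBinom r m
    omega
  · rw [show (2 * m + 1) / 2 = m by omega]
    rcases r with _ | r
    · have := Nat.centralBinom_pos m
      simp
      omega
    · rw [Nat.choose_succ_succ']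
      have := Nat.choose_le_centralBinom r m
      have := Nat.choose_le_centralBinom (r + 1) m
      omega

/-- For degrees at most `n / 2 + c` there are at most `3 / 4 * 2 ^ n` multilinear monomials. -/
theorem card_small_subsets_le {n d c : ℕ} (hd : 2 * d ≤ n + 2 * c)
    (hn : 64 * (2 * c + 1) ^ 2 ≤ n) :
    4 * (Finset.univ.filter fun s : Finset (Fin n) => s.card ≤ d).card ≤ 3 * 2 ^ n := by
  let A := Finset.univ.filter fun s : Finset (Fin n) => s.card + d < n
  let B := Finset.univ.filter fun s : Finset (Fin n) => s.card ≤ d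
  let U := Finset.univ.filter fun s : Finset (Fin n) => ¬ s.card ≤ d
  have hU : U.card = A.card := by
    refine Finset.card_bij' (fun s _ => sᶜ) (fun s _ => sᶜ) ?_ ?_ ?_ ?_
    · intro s hs
      simp only [U, A, Finset.mem_filter, Finset.mem_univ, true_and, Finset.card_compl,
        Fintype.card_fin] at hs ⊢
      have := Finset.card_le_univ s
      rw [Fintype.card_fin] at this
      omega
    · intro s hs
      simp only [U, A, Finset.mem_filter, Finset.mem_univ, true_and, Finset.card_compl,
        Fintype.card_fin] at hs ⊢
      omega
    · intro s _; simp
    · intro s _; simp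
  have htot : B.card + U.card = 2 ^ n := by
    have h := Finset.card_filter_add_card_filter_not (s := (Finset.univ : Finset (Finset (Fin n))))
      (fun s => s.card ≤ d)
    rwa [Finset.card_univ, Fintype.card_finset, Fintype.card_fin] at h
  have hB : B.card ≤ A.card + (2 * c + 1) * (2 * (n / 2).centralBinom) := by
    -- By complementation the small sets `A` are as many as those outside `B`; at most `2 * c + 1`
    -- middle layers remain.
    have hsub : B ⊆ A ∪ (Finset.Icc (n - d) d).biUnion
        fun r => Finset.powersetCard r Finset.univ := by
      intro s hs
      simp only [B, A, Finset.mem_filter, Finset.mem_univ, true_and, Finset.mem_union,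
        Finset.mem_biUnion, Finset.mem_Icc, Finset.mem_powersetCard, Finset.subset_univ] at hs ⊢
      by_cases h : s.card + d < n
      · exact Or.inl h
      · exact Or.inr ⟨s.card, ⟨by omega, hs⟩, rfl⟩
    refine (Finset.card_le_card hsub).trans ((Finset.card_union_le _ _).trans ?_)
    refine Nat.add_le_add_left (Finset.card_biUnion_le.trans ?_) _
    refine (Finset.sum_le_card_nsmul _ _ (2 * (n / 2).centralBinom) fun r _ => ?_).trans ?_
    · rw [Finset.card_powersetCard, Finset.card_univ, Fintype.card_fin]
      exact choose_le_two_mul_centralBinom_half n r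
    · rw [Nat.card_Icc, smul_eq_mul]
      exact Nat.mul_le_mul_right _ (by omega)
  have hcent : 4 * ((2 * c + 1) * (n / 2).centralBinom) ≤ 2 ^ n := by
    have h1 := two_mul_add_one_mul_centralBinom_sq_le (n / 2)
    have h2 : (4 * ((2 * c + 1) * (n / 2).centralBinom)) ^ 2 ≤ (2 ^ n) ^ 2 := by
      calc (4 * ((2 * c + 1) * (n / 2).centralBinom)) ^ 2
          = (16 * (2 * c + 1) ^ 2) * (n / 2).centralBinom ^ 2 := by ring
        _ ≤ (2 * (n / 2) + 1) * (n / 2).centralBinom ^ 2 := by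
          gcongr
          omega
        _ ≤ 16 ^ (n / 2) := h1
        _ = 2 ^ (4 * (n / 2)) := by rw [pow_mul]; norm_num
        _ ≤ 2 ^ (n * 2) := Nat.pow_le_pow_right (by norm_num) (by omega)
        _ = (2 ^ n) ^ 2 := pow_mul _ _ _
    exact (Nat.pow_le_pow_iff_left (by norm_num)).1 h2
  change 4 * B.card ≤ _
  rw [hU] at htot
  nlinarith

/-- Over 𝔽₂ positive powers of a variable equal the variable, so the multilinear monomials of degree
at most `d` span. -/
theorem natCard_degLE_le (n d : ℕ) :
    Nat.card {f : BoolFn n // DegLE d f} ≤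
      2 ^ (Finset.univ.filter fun s : Finset (Fin n) => s.card ≤ d).card := by
  classical
  let mon : Finset (Fin n) → BoolFn n := fun s x => ∏ i ∈ s, x i
  let F := Finset.univ.filter fun s : Finset (Fin n) => s.card ≤ d
  let W := Submodule.span (ZMod 2) ((F.image mon : Finset (BoolFn n)) : Set (BoolFn n))
  have hmem : ∀ f : BoolFn n, DegLE d f → f ∈ W := by
    intro f hf
    obtain ⟨p, hp, hf⟩ := mem_RM_iff.2 hf
    have hsum : f = ∑ s ∈ p.support, p.coeff s • mon s.support := by
      funext x
      rw [← hf, MvPolynomial.eval_eq, Finset.sum_apply]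
      refine Finset.sum_congr rfl fun s _ => ?_
      rw [Pi.smul_apply, smul_eq_mul]
      congr 1
      refine Finset.prod_congr rfl fun i hi => ?_
      rcases zmod_two_cases (x i) with h | h
      · rw [h, zero_pow (Finsupp.mem_support_iff.1 hi)]
      · rw [h, one_pow]
    rw [hsum]
    refine Submodule.sum_mem _ fun s hs => Submodule.smul_mem _ _ (Submodule.subset_span ?_)
    refine Finset.mem_coe.2 (Finset.mem_image_of_mem _ ?_)
    simp only [F, Finset.mem_filter, Finset.mem_univ, true_and]
    refine le_trans ?_ ((MvPolynomial.le_totalDegree hs).trans hp)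
    rw [Finset.card_eq_sum_ones]
    exact Finset.sum_le_sum fun i hi => Nat.one_le_iff_ne_zero.2 (Finsupp.mem_support_iff.1 hi)
  have h1 : Nat.card {f : BoolFn n // DegLE d f} ≤ Nat.card W :=
    Nat.card_le_card_of_injective (fun f => (⟨f.1, hmem f.1 f.2⟩ : W)) fun f g h => by
      simpa [Subtype.ext_iff] using h
  refine h1.trans ((natCard_span_le_two_pow _).trans ?_)
  exact Nat.pow_le_pow_right (by norm_num) Finset.card_image_le

/-- The volume of the Hamming ball of relative radius `1 / 64`. -/
theorem card_ball_le {α : Type*} [Fintype α] [DecidableEq α] (L : ℕ)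
    (hα : Fintype.card α = 64 * L) :
    16 ^ (63 * L) * (Finset.univ.filter fun D : Finset α => D.card ≤ L).card ≤ 17 ^ (64 * L) := by
  have h := Finset.sum_pow_mul_eq_add_pow 1 16 (Finset.univ : Finset α)
  rw [Finset.card_univ, hα, Finset.powerset_univ] at h
  rw [show 17 = 1 + 16 by norm_num, ← h, mul_comm, ← smul_eq_mul]
  refine (Finset.card_nsmul_le_sum _ (fun D => 1 ^ D.card * 16 ^ (64 * L - D.card)) _ ?_).trans
    (Finset.sum_le_sum_of_subset (Finset.subset_univ _))
  intro D hD
  rw [Finset.mem_filter] at hD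
  rw [one_pow, one_mul]
  exact Nat.pow_le_pow_right (by norm_num) (by omega)

/-- For degrees at most `n / 2 + c` some function is far from the Reed-Muller code. -/
theorem exists_isFar_const {n d c : ℕ} (hd : 2 * d ≤ n + 2 * c)
    (hn : 64 * (2 * c + 1) ^ 2 ≤ n) : ∃ h : BoolFn n, IsFar (1 / 64) h (RM d n) := by
  classical
  by_contra! hcon
  have hn6 : 6 ≤ n := by nlinarith [Nat.zero_le c]
  obtain ⟨m, rfl⟩ := Nat.exists_eq_add_of_le hn6
  have hcube : Fintype.card (Cube (6 + m)) = 64 * 2 ^ m := by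
    rw [card_cube, pow_add]; norm_num
  let B := Finset.univ.filter fun D : Finset (Cube (6 + m)) => D.card ≤ 2 ^ m
  have hclose : ∀ h : BoolFn (6 + m), ∃ g : {f : BoolFn (6 + m) // DegLE d f},
      (Finset.univ.filter fun x => h x ≠ g.1 x) ∈ B := by
    intro h
    have := hcon h
    unfold IsFar at this
    push Not at this
    obtain ⟨g, hg, hlt⟩ := this
    refine ⟨⟨g, mem_RM_iff.1 hg⟩, ?_⟩
    simp only [B, Finset.mem_filter, Finset.mem_univ, true_and]
    unfold relDist at hlt
    rw [div_lt_div_iff₀ (by positivity) (by norm_num), one_mul, pow_add] at hlt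
    have h2 : ((Finset.univ.filter fun x => h x ≠ g x).card : ℝ) ≤ (2 : ℝ) ^ m := by linarith
    exact_mod_cast h2
  choose G hG using hclose
  -- If every function were close, it would be determined by a codeword and a small error set.
  have hinj : Function.Injective
      fun h => ((G h, ⟨_, hG h⟩) : {f : BoolFn (6 + m) // DegLE d f} × B) := by
    intro h h' hh
    simp only [Prod.mk.injEq, Subtype.mk.injEq] at hh
    funext x
    have hx := Finset.ext_iff.1 hh.2 x
    simp only [Finset.mem_filter, Finset.mem_univ, true_and, hh.1] at hx
    revert hx
    generalize (G h').1 x = z, h x = z', h' x = z''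
    revert z z' z''
    decide
  have h1 := Nat.card_le_card_of_injective _ hinj
  rw [Nat.card_prod, Nat.card_eq_fintype_card, Fintype.card_fun, ZMod.card, hcube,
    Nat.card_eq_fintype_card (α := B), Fintype.card_coe] at h1
  have h2 := natCard_degLE_le (6 + m) d
  have h3 : 2 ^ (Finset.univ.filter fun s : Finset (Fin (6 + m)) => s.card ≤ d).card ≤
      2 ^ (48 * 2 ^ m) := by
    refine Nat.pow_le_pow_right (by norm_num) ?_
    have := card_small_subsets_le hd hn
    rw [pow_add] at this
    omega
  have h4 := card_ball_le (2 ^ m) hcube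
  -- Taking `2 ^ m`-th roots, this would say 2^316 ≤ 2^48 * 17^64, which is false.
  have h5 : 16 ^ (63 * 2 ^ m) * 2 ^ (64 * 2 ^ m) ≤ 2 ^ (48 * 2 ^ m) * 17 ^ (64 * 2 ^ m) := by
    calc 16 ^ (63 * 2 ^ m) * 2 ^ (64 * 2 ^ m)
        ≤ 16 ^ (63 * 2 ^ m) * (2 ^ (48 * 2 ^ m) * B.card) := by
          gcongr
          exact h1.trans (Nat.mul_le_mul_right _ (h2.trans h3))
      _ = 2 ^ (48 * 2 ^ m) * (16 ^ (63 * 2 ^ m) * B.card) := by ring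
      _ ≤ _ := Nat.mul_le_mul_left _ h4
  rw [pow_mul, pow_mul, pow_mul, pow_mul, ← mul_pow, ← mul_pow] at h5
  exact absurd h5 (not_le.2 (Nat.pow_lt_pow_left (by norm_num) (by positivity)))

/-! ### Affine hyperplanes and incidence counts -/

/-- Affine hyperplanes `{x | a ⬝ x + b = 0}`, `a ≠ 0`. -/
abbrev Hyp (n : ℕ) : Type := {a : Cube n // a ≠ 0} × ZMod 2

/-- The affine functional that vanishes on the hyperplane `h`. -/
def Hyp.fn {n : ℕ} (h : Hyp n) : BoolFn n := fun x => dotProduct h.1.1 x + h.2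

theorem Hyp.isAff {n : ℕ} (h : Hyp n) : IsAff h.fn :=
  isAff_dotProduct_add _ _

theorem card_hyp (n : ℕ) : (Fintype.card (Hyp n) : ℝ) = 2 * (2 ^ n - 1) := by
  rw [Fintype.card_prod, ZMod.card, Fintype.card_subtype_compl, card_cube,
    Fintype.card_subtype_eq, Nat.cast_mul, Nat.cast_sub Nat.one_le_two_pow]
  push_cast
  ring

namespace Hyp

variable {n : ℕ}

/-- A coordinate on which the functional depends. -/
noncomputable def pivot (h : Hyp (n + 1)) : Fin (n + 1) :=
  (Function.ne_iff.1 h.1.2).choose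

theorem pivot_spec (h : Hyp (n + 1)) : h.1.1 h.pivot = 1 :=
  (zmod_two_cases _).resolve_left (Function.ne_iff.1 h.1.2).choose_spec

/-- An affine parametrization of a hyperplane. -/
noncomputable def param (h : Hyp (n + 1)) (y : Cube n) : Cube (n + 1) :=
  h.pivot.insertNth (α := fun _ => ZMod 2) (∑ j, h.1.1 (h.pivot.succAbove j) * y j + h.2) y

/-- The affine left inverse of `Hyp.param`. -/
noncomputable def proj (h : Hyp (n + 1)) (x : Cube (n + 1)) : Cube n :=
  fun j => x (h.pivot.succAbove j)

theorem proj_param (h : Hyp (n + 1)) (y : Cube n) : h.proj (h.param y) = y := by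
  funext j
  simp [proj, param]

theorem fn_eq_sum (h : Hyp (n + 1)) (x : Cube (n + 1)) :
    h.fn x = x h.pivot + (∑ j, h.1.1 (h.pivot.succAbove j) * x (h.pivot.succAbove j) + h.2) := by
  rw [fn, dotProduct, Fin.sum_univ_succAbove _ h.pivot, pivot_spec]
  ring

theorem fn_param (h : Hyp (n + 1)) (y : Cube n) : h.fn (h.param y) = 0 := by
  rw [fn_eq_sum]
  simp only [param, Fin.insertNth_apply_same, Fin.insertNth_apply_succAbove]
  exact zmod_two_add_self _

theorem param_proj (h : Hyp (n + 1)) {x : Cube (n + 1)} (hx : h.fn x = 0) :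
    h.param (h.proj x) = x := by
  rw [fn_eq_sum, CharTwo.add_eq_zero] at hx
  funext i
  rcases Fin.eq_self_or_eq_succAbove h.pivot i with rfl | ⟨j, rfl⟩
  · simp [param, proj, hx]
  · simp [param, proj]

theorem isAffMap_param (h : Hyp (n + 1)) : IsAffMap h.param := by
  intro i
  rcases Fin.eq_self_or_eq_succAbove h.pivot i with hi | ⟨j, hi⟩
  · rw [hi]
    simp only [param, Fin.insertNth_apply_same]
    exact isAff_dotProduct_add _ _
  · rw [hi]
    simp only [param, Fin.insertNth_apply_succAbove]
    exact IsAff.coord j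

theorem isAffMap_proj (h : Hyp (n + 1)) : IsAffMap h.proj :=
  fun _ => IsAff.coord _

theorem card_filter_param (h : Hyp (n + 1)) (p : Cube (n + 1) → Prop) [DecidablePred p] :
    (Finset.univ.filter fun y => p (h.param y)).card =
      (Finset.univ.filter fun x => p x ∧ h.fn x = 0).card := by
  refine Finset.card_bij' (fun y _ => h.param y) (fun x _ => h.proj x) ?_ ?_ ?_ ?_
  · intro y hy
    simpa [fn_param] using hy
  · intro x hx
    simp only [Finset.mem_filter, Finset.mem_univ, true_and] at hx ⊢
    rw [h.param_proj hx.2]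
    exact hx.1
  · intro y _
    exact h.proj_param y
  · intro x hx
    simp only [Finset.mem_filter, Finset.mem_univ, true_and] at hx
    exact h.param_proj hx.2

/-- Half of the hyperplanes contain a given point. -/
theorem card_filter_fn_eq_zero (x : Cube n) :
    ((Finset.univ.filter fun h : Hyp n => h.fn x = 0).card : ℝ) = 2 ^ n - 1 := by
  have h1 : (Finset.univ.filter fun h : Hyp n => h.fn x = 0).card =
      Fintype.card {a : Cube n // a ≠ 0} := by
    rw [← Finset.card_univ]
    refine Finset.card_bij' (fun h _ => h.1) (fun a _ => (a, dotProduct a.1 x)) ?_ ?_ ?_ ?_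
    · simp
    · intro a _
      exact Finset.mem_filter.2 ⟨Finset.mem_univ _, zmod_two_add_self _⟩
    · intro h hh
      simp only [fn, Finset.mem_filter, Finset.mem_univ, true_and, CharTwo.add_eq_zero] at hh
      exact Prod.ext rfl hh
    · simp
  rw [h1, Fintype.card_subtype_compl, card_cube, Fintype.card_subtype_eq,
    Nat.cast_sub Nat.one_le_two_pow]
  simp

/-- At most a quarter of the hyperplanes contain two given points. -/
theorem card_filter_fn_eq_zero_and_le {x y : Cube n} (hxy : x ≠ y) :
    4 * ((Finset.univ.filter fun h : Hyp n => h.fn x = 0 ∧ h.fn y = 0).card : ℝ) ≤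
      Fintype.card (Hyp n) := by
  classical
  have h1 : (Finset.univ.filter fun h : Hyp n => h.fn x = 0 ∧ h.fn y = 0).card ≤
      ((Finset.univ.filter fun a : Cube n => dotProduct a (x - y) = 0).erase 0).card := by
    refine Finset.card_le_card_of_injOn (fun h => h.1.1) ?_ ?_
    · intro h hh
      simp only [fn, Finset.coe_filter, Finset.mem_univ, true_and, Set.mem_ofPred_eq,
        CharTwo.add_eq_zero] at hh
      simp [dotProduct_sub, hh.1, hh.2, h.1.2]
    · intro h hh h' hh' e
      simp only [fn, Finset.coe_filter, Finset.mem_univ, true_and, Set.mem_ofPred_eq,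
        CharTwo.add_eq_zero] at hh hh'
      have e' : h.1.1 = h'.1.1 := e
      exact Prod.ext (Subtype.ext e') (by rw [← hh.1, ← hh'.1, e'])
  rw [Finset.card_erase_of_mem (by simp)] at h1
  have h2 := two_mul_card_filter_dotProduct (sub_ne_zero.2 hxy) 0
  have h3 : 1 ≤ (Finset.univ.filter fun a : Cube n => dotProduct a (x - y) = 0).card :=
    Finset.card_pos.2 ⟨0, by simp⟩
  have h4 : 4 * (Finset.univ.filter fun h : Hyp n => h.fn x = 0 ∧ h.fn y = 0).card + 4 ≤
      2 * 2 ^ n := by omega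
  have h5 : 4 * ((Finset.univ.filter fun h : Hyp n => h.fn x = 0 ∧ h.fn y = 0).card : ℝ) + 4 ≤
      2 * 2 ^ n := by exact_mod_cast h4
  rw [card_hyp]
  linarith

/-- First moment of the number of points of `E` on a random hyperplane; the next lemma bounds the
second factorial moment. Passing to a hyperplane thus divides them by exactly 2 and by at least 4.
-/
theorem sum_card_filter (E : Finset (Cube n)) :
    ∑ h : Hyp n, ((E.filter fun x => h.fn x = 0).card : ℝ) =
      E.card * (Fintype.card (Hyp n) / 2) := by
  simp only [Finset.card_filter, Nat.cast_sum]
  rw [Finset.sum_comm]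
  have : ∀ x : Cube n, ∑ h : Hyp n, ((if h.fn x = 0 then 1 else 0 : ℕ) : ℝ) =
      Fintype.card (Hyp n) / 2 := by
    intro x
    rw [← Nat.cast_sum, ← Finset.card_filter, card_filter_fn_eq_zero, card_hyp]
    ring
  simp only [this, Finset.sum_const, nsmul_eq_mul]

theorem sum_card_filter_mul_le (E : Finset (Cube n)) :
    ∑ h : Hyp n, (((E.filter fun x => h.fn x = 0).card : ℝ) *
      ((E.filter fun x => h.fn x = 0).card - 1)) ≤
      (E.card * (E.card - 1)) * (Fintype.card (Hyp n) / 4) := by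
  classical
  have key : ∀ F : Finset (Cube n), (F.card : ℝ) * (F.card - 1) = (F.offDiag.card : ℝ) := by
    intro F
    rw [Finset.offDiag_card, Nat.cast_sub (Nat.le_mul_self _)]
    push_cast
    ring
  simp only [key]
  have hoff : ∀ h : Hyp n, (E.filter fun x => h.fn x = 0).offDiag =
      E.offDiag.filter fun p => h.fn p.1 = 0 ∧ h.fn p.2 = 0 := by
    intro h
    ext p
    simp only [Finset.mem_offDiag, Finset.mem_filter]
    tauto
  simp only [hoff, Finset.card_filter, Nat.cast_sum]
  rw [Finset.sum_comm, ← nsmul_eq_mul]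
  refine Finset.sum_le_card_nsmul _ _ _ fun p hp => ?_
  rw [← Nat.cast_sum, ← Finset.card_filter]
  have := card_filter_fn_eq_zero_and_le (Finset.mem_offDiag.1 hp).2.2
  linarith

end Hyp

/-! ### Rejection probability of the flat test near the code -/

/-- The probability that `f` is found not to have degree at most `d` on a random flat of
dimension `d + 6`, chosen as the last term of a random descending chain of flats. -/
noncomputable def flatRej (d : ℕ) : (m : ℕ) → BoolFn (d + 6 + m) → ℝ
  | 0, f => open Classical in if DegLE d f then 0 else 1
  | m + 1, f => (∑ h : Hyp (d + 6 + m + 1), flatRej d m fun y => f (h.param y)) /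
      Fintype.card (Hyp (d + 6 + m + 1))

theorem flatRej_nonneg (d m : ℕ) (f : BoolFn (d + 6 + m)) : 0 ≤ flatRej d m f := by
  induction m with
  | zero => unfold flatRej; split_ifs <;> norm_num
  | succ m ih =>
    unfold flatRej
    exact div_nonneg (Finset.sum_nonneg fun h _ => ih _) (by positivity)

theorem card_hyp_succ_pos (n : ℕ) : 0 < (Fintype.card (Hyp (n + 1)) : ℝ) := by
  rw [card_hyp]
  have : (1 : ℝ) ≤ 2 ^ n := one_le_pow₀ (by norm_num)
  rw [pow_succ]
  linarith

/-- If X is the number of errors on the final flat, X(64 - X)/1024 is at most the indicator of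
rejection: it never exceeds 1, and when the restriction has degree at most `d`, minimum distance
forces X = 0 or X ≥ 64. Take expectations of X(64 - X) = 63X - X(X - 1). -/
theorem flatRej_ge_quadratic (d m : ℕ) (f g : BoolFn (d + 6 + m)) (hg : DegLE d g) :
    (1 / 1024 : ℝ) * (63 * ((Finset.univ.filter fun x => f x ≠ g x).card / 2 ^ m) -
      (Finset.univ.filter fun x => f x ≠ g x).card *
        ((Finset.univ.filter fun x => f x ≠ g x).card - 1) / 4 ^ m) ≤ flatRej d m f := by
  induction m with
  | zero =>
    unfold flatRej
    set e := (Finset.univ.filter fun x => f x ≠ g x).card with he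
    have he' : (e : ℝ) * (64 - e) ≤ 1024 := by nlinarith [sq_nonneg ((e : ℝ) - 32)]
    split_ifs with hf
    · have : e = 0 ∨ 64 ≤ e := by
        by_cases hne : ∃ x, f x + g x ≠ 0
        · right
          have h1 := (hf.add hg).two_pow_le hne
          have h2 : (fnSupport fun x => f x + g x) = Finset.univ.filter fun x => f x ≠ g x := by
            ext x
            simp [mem_fnSupport, CharTwo.add_eq_zero]
          rw [h2, ← he, add_zero, pow_add] at h1
          exact Nat.le_of_mul_le_mul_left h1 (by positivity)
        · left
          push Not at hne
          rw [he, Finset.card_eq_zero, Finset.filter_eq_empty_iff]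
          intro x _
          simpa [CharTwo.add_eq_zero] using hne x
      rcases this with h0 | h64
      · rw [h0]; norm_num
      · have : (64 : ℝ) ≤ e := by exact_mod_cast h64
        norm_num
        nlinarith
    · norm_num
      nlinarith
  | succ m ih =>
    unfold flatRej
    set E := Finset.univ.filter fun x => f x ≠ g x with hE
    have hpos := card_hyp_succ_pos (d + 6 + m)
    rw [le_div_iff₀ hpos]
    have hcard : ∀ h : Hyp (d + 6 + m + 1),
        (Finset.univ.filter fun y => f (h.param y) ≠ g (h.param y)).card =
          (E.filter fun x => h.fn x = 0).card := by
      intro h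
      rw [h.card_filter_param fun x => f x ≠ g x, hE, Finset.filter_filter]
    have h1 := Hyp.sum_card_filter E
    have h2 := Hyp.sum_card_filter_mul_le E
    have h3 : ∀ h ∈ (Finset.univ : Finset (Hyp (d + 6 + m + 1))), (1 / 1024 : ℝ) *
        (63 * ((E.filter fun x => h.fn x = 0).card / 2 ^ m) -
        (E.filter fun x => h.fn x = 0).card * ((E.filter fun x => h.fn x = 0).card - 1) / 4 ^ m) ≤
        flatRej d m fun y => f (h.param y) := by
      intro h _
      have := ih (fun y => f (h.param y)) (fun y => g (h.param y)) (hg.comp h.isAffMap_param)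
      rwa [hcard h] at this
    refine le_trans ?_ (Finset.sum_le_sum h3)
    rw [← Finset.mul_sum, Finset.sum_sub_distrib, ← Finset.mul_sum, ← Finset.sum_div,
      ← Finset.sum_div, mul_assoc]
    refine mul_le_mul_of_nonneg_left ?_ (by norm_num)
    have h4 := div_le_div_of_nonneg_right h2 (show (0 : ℝ) ≤ 4 ^ m by positivity)
    change _ ≤ 63 * ((∑ h : Hyp (d + 6 + m + 1), ((E.filter fun x => h.fn x = 0).card : ℝ)) / 2 ^ m)
      - (∑ h : Hyp (d + 6 + m + 1), (((E.filter fun x => h.fn x = 0).card : ℝ) *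
      ((E.filter fun x => h.fn x = 0).card - 1))) / 4 ^ m
    refine le_trans (le_of_eq ?_) (sub_le_sub_left h4 _)
    erw [h1]
    rw [pow_succ, pow_succ]
    field_simp
    ring_nf

/-- The rejection probability is at least proportional to the distance, for close functions. -/
theorem flatRej_ge_of_close (d m : ℕ) (f g : BoolFn (d + 6 + m)) (hg : DegLE d g)
    (hclose : 2 ^ d * relDist f g ≤ 1 / 2) : 2 ^ d * relDist f g ≤ flatRej d m f := by
  refine le_trans ?_ (flatRej_ge_quadratic d m f g hg)
  unfold relDist at hclose ⊢
  set e : ℝ := ((Finset.univ.filter fun x => f x ≠ g x).card : ℝ)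
  have hμ : 2 ^ d * (e / 2 ^ (d + 6 + m)) = e / 2 ^ m / 64 := by
    rw [pow_add, pow_add]
    field_simp
    norm_num
  rw [hμ] at hclose ⊢
  have h4 : e * (e - 1) / 4 ^ m ≤ (e / 2 ^ m) ^ 2 := by
    rw [div_pow, ← pow_mul, mul_comm m 2, pow_mul]
    norm_num
    gcongr
    have : 0 ≤ e := Nat.cast_nonneg _
    nlinarith
  have h0 : 0 ≤ e / 2 ^ m := by positivity
  -- With μ = e / 2^m ≤ 32, 63μ - μ² is at least 31μ, and 16μ is needed.
  nlinarith

/-! ### From closeness on many hyperplanes to global closeness -/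

/-- The sign character of `𝔽₂`. -/
noncomputable def zmodSign (z : ZMod 2) : ℝ := if z = 0 then 1 else -1

theorem zmodSign_mul_self (z : ZMod 2) : zmodSign z * zmodSign z = 1 := by
  unfold zmodSign; split_ifs <;> norm_num

theorem zmodSign_add (z w : ZMod 2) : zmodSign (z + w) = zmodSign z * zmodSign w := by
  unfold zmodSign
  rcases zmod_two_cases z with rfl | rfl <;> rcases zmod_two_cases w with rfl | rfl <;>
    simp [zmod_two_add_self]

/-- Complementary hyperplanes have opposite signs everywhere; for distinct normals, a shift along a
suitable direction negates the product, so the sum is 0. -/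
theorem sum_zmodSign_mul_le {n : ℕ} {h h' : Hyp n} (hne : h ≠ h') :
    ∑ x, zmodSign (h.fn x) * zmodSign (h'.fn x) ≤ 0 := by
  by_cases ha : h.1 = h'.1
  · have hb : h.2 ≠ h'.2 := fun hb => hne (Prod.ext ha hb)
    refine Finset.sum_nonpos fun x _ => ?_
    rw [← zmodSign_add, Hyp.fn, Hyp.fn, ha]
    have : dotProduct h'.1.1 x + h.2 + (dotProduct h'.1.1 x + h'.2) = 1 := by
      revert hb
      generalize dotProduct h'.1.1 x = z, h.2 = b, h'.2 = b'
      revert z b b'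
      decide
    rw [this]
    simp [zmodSign]
  · obtain ⟨v, hv⟩ := exists_dotProduct_eq_one (a := h.1.1 + h'.1.1) (by
      intro h0
      apply ha
      refine Subtype.ext (funext fun i => ?_)
      exact CharTwo.add_eq_zero.1 (congrFun h0 i))
    have hneg : ∑ x, zmodSign (h.fn x) * zmodSign (h'.fn x) =
        ∑ x, -(zmodSign (h.fn x) * zmodSign (h'.fn x)) := by
      refine Fintype.sum_equiv (Equiv.addRight v) _ _ fun x => ?_
      rw [← zmodSign_add, ← zmodSign_add, Equiv.coe_addRight]
      have : h.fn (x + v) + h'.fn (x + v) = h.fn x + h'.fn x + 1 := by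
        rw [← hv]
        simp only [Hyp.fn, dotProduct_add, add_dotProduct]
        ring
      rw [this, zmodSign_add (h.fn x + h'.fn x) 1]
      simp [zmodSign]
    rw [Finset.sum_neg_distrib] at hneg
    linarith

theorem sum_sq_sum_zmodSign_le {n : ℕ} (S : Finset (Hyp n)) :
    ∑ x, (∑ h ∈ S, zmodSign (h.fn x)) ^ 2 ≤ S.card * 2 ^ n := by
  classical
  simp only [sq, Finset.sum_mul_sum]
  rw [Finset.sum_comm, ← nsmul_eq_mul]
  refine Finset.sum_le_card_nsmul _ _ _ fun h hh => ?_
  rw [Finset.sum_comm, ← Finset.add_sum_erase S _ hh]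
  have h1 : ∑ x, zmodSign (h.fn x) * zmodSign (h.fn x) = 2 ^ n := by
    simp [zmodSign_mul_self]
  have h2 : ∑ h' ∈ S.erase h, ∑ x, zmodSign (h.fn x) * zmodSign (h'.fn x) ≤ 0 :=
    Finset.sum_nonpos fun h' hh' => sum_zmodSign_mul_le (Finset.ne_of_mem_erase hh').symm
  linarith

/-- A set that meets each of `K` hyperplanes in at most `t` points is small. -/
theorem card_le_of_card_inter_hyp_le {n : ℕ} (S : Finset (Hyp n)) (D : Finset (Cube n)) (t : ℝ)
    (hD : ∀ h ∈ S, ((D.filter fun x => h.fn x = 0).card : ℝ) ≤ t) :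
    (S.card : ℝ) * D.card ≤ 2 ^ n + 4 * S.card * t := by
  rcases S.eq_empty_or_nonempty with rfl | hne
  · simp
  have hK : (0 : ℝ) < S.card := by exact_mod_cast hne.card_pos
  have hm : ∀ x, ∑ h ∈ S, zmodSign (h.fn x) =
      2 * ((S.filter fun h => h.fn x = 0).card : ℝ) - S.card := by
    intro x
    have : ∀ h ∈ S, zmodSign (h.fn x) = 2 * (if h.fn x = 0 then 1 else 0) - 1 := by
      intro h _
      unfold zmodSign
      split_ifs <;> norm_num
    rw [Finset.sum_congr rfl this, Finset.sum_sub_distrib, ← Finset.mul_sum, Finset.sum_boole]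
    simp
  have hsum : ∑ x ∈ D, ((S.filter fun h => h.fn x = 0).card : ℝ) ≤ S.card * t := by
    have : ∑ x ∈ D, ((S.filter fun h => h.fn x = 0).card : ℝ) =
        ∑ h ∈ S, ((D.filter fun x => h.fn x = 0).card : ℝ) := by
      simp only [Finset.card_filter, Nat.cast_sum]
      exact Finset.sum_comm
    rw [this, ← nsmul_eq_mul]
    exact Finset.sum_le_card_nsmul _ _ _ hD
  -- If m of the K hyperplanes contain x, the sign sum is 2m - K and K² - (2m - K)² ≤ 4Km. Points of
  -- `D` on few hyperplanes have a large sign sum, which near-orthogonality makes rare.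
  have hlow : ∑ x ∈ D, ((S.card : ℝ) ^ 2 - (∑ h ∈ S, zmodSign (h.fn x)) ^ 2) ≤
      ∑ x ∈ D, 4 * S.card * ((S.filter fun h => h.fn x = 0).card : ℝ) := by
    refine Finset.sum_le_sum fun x _ => ?_
    rw [hm]
    nlinarith [sq_nonneg ((S.filter fun h => h.fn x = 0).card : ℝ)]
  rw [Finset.sum_sub_distrib, Finset.sum_const, nsmul_eq_mul, ← Finset.mul_sum] at hlow
  have hsq : ∑ x ∈ D, (∑ h ∈ S, zmodSign (h.fn x)) ^ 2 ≤ S.card * 2 ^ n :=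
    (Finset.sum_le_sum_of_subset_of_nonneg (Finset.subset_univ D)
      fun _ _ _ => sq_nonneg _).trans (sum_sq_sum_zmodSign_le S)
  have h1 : (S.card : ℝ) * (S.card * D.card) ≤ S.card * (2 ^ n + 4 * S.card * t) := by
    nlinarith
  exact le_of_mul_le_mul_left h1 hK

/-- A vector outside a subspace is separated from it by a linear functional. -/
theorem exists_dotProduct_separating {n : ℕ} (W : Submodule (ZMod 2) (Cube n)) {a : Cube n}
    (ha : a ∉ W) : ∃ v : Cube n, dotProduct a v = 1 ∧ ∀ w ∈ W, dotProduct w v = 0 := by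
  obtain ⟨φ, hφa, hφW⟩ := Submodule.exists_le_ker_of_notMem ha
  have hφ : ∀ x, dotProduct x (fun i => φ (Pi.single i 1)) = φ x := by
    intro x
    conv_rhs => rw [pi_eq_sum_univ' x]
    simp [dotProduct, map_sum]
  refine ⟨fun i => φ (Pi.single i 1), ?_, fun w hw => ?_⟩
  · rw [hφ]
    exact (zmod_two_cases _).resolve_left hφa
  · rw [hφ]
    exact hφW hw

/-- The normal vectors of a set of hyperplanes. -/
def normals {n : ℕ} (J : Finset (Hyp n)) : Finset (Cube n) := J.image fun h => h.1.1

/-- Among many hyperplanes there is one whose normal vector is outside the span of a few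
given ones. -/
theorem exists_hyp_notMem_span {n i : ℕ} (S J : Finset (Hyp n)) (hJ : J.card = i)
    (hS : 2 * 2 ^ i < S.card) :
    ∃ h ∈ S, h.1.1 ∉ Submodule.span (ZMod 2) (normals J : Set (Cube n)) := by
  classical
  by_contra! hcon
  let W := Submodule.span (ZMod 2) (normals J : Set (Cube n))
  have h1 : Nat.card S ≤ Nat.card (W × ZMod 2) :=
    Nat.card_le_card_of_injective
      (fun h : S => ((⟨h.1.1.1, hcon h.1 h.2⟩, h.1.2) : W × ZMod 2)) (by
        intro h h' e
        simp only [Prod.mk.injEq, Subtype.mk.injEq] at e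
        exact Subtype.ext (Prod.ext (Subtype.ext e.1) e.2))
  have h2 : Nat.card W ≤ 2 ^ i := by
    refine (natCard_span_le_two_pow _).trans (Nat.pow_le_pow_right (by norm_num) ?_)
    rw [← hJ]
    exact Finset.card_image_le
  rw [Nat.card_prod, Nat.card_zmod, Nat.card_eq_fintype_card, Fintype.card_coe] at h1
  omega

/-- Consistent functions of degree at most `d` on hyperplanes with independent normal vectors
can be glued. -/
theorem exists_glue {n d : ℕ} (S : Finset (Hyp n)) (P : Hyp n → BoolFn n)
    (hP : ∀ h ∈ S, DegLE d (P h))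
    (hcons : ∀ h ∈ S, ∀ h' ∈ S, ∀ x, h.fn x = 0 → h'.fn x = 0 → P h x = P h' x)
    (i : ℕ) (hi : 2 ^ i < S.card) :
    ∃ J ⊆ S, J.card = i ∧
      2 ^ i * (Finset.univ.filter fun x : Cube n => ∀ h ∈ J, h.fn x = 1).card ≤ 2 ^ n ∧
      ∃ g : BoolFn n, DegLE d g ∧ ∀ h ∈ J, ∀ x, h.fn x = 0 → g x = P h x := by
  classical
  induction i with
  | zero =>
    refine ⟨∅, by simp, rfl, ?_, fun _ => 0, .const d 0, by simp⟩
    rw [pow_zero, one_mul, ← card_cube]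
    exact Finset.card_le_univ _
  | succ i ih =>
    obtain ⟨J, hJS, hJ, hU, g, hg, hgJ⟩ := ih (lt_trans (Nat.pow_lt_pow_succ (by norm_num)) hi)
    obtain ⟨k, hkS, hk⟩ := exists_hyp_notMem_span S J hJ (by rwa [pow_succ, mul_comm] at hi)
    obtain ⟨v, hkv, hv⟩ := exists_dotProduct_separating _ hk
    have hJv : ∀ h ∈ J, dotProduct h.1.1 v = 0 := fun h hh =>
      hv _ (Submodule.subset_span (Finset.mem_coe.2 (Finset.mem_image_of_mem _ hh)))
    have hkJ : k ∉ J := fun hkJ => by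
      have := hJv k hkJ
      rw [hkv] at this
      exact one_ne_zero this
    refine ⟨insert k J, Finset.insert_subset hkS hJS, by rw [Finset.card_insert_of_notMem hkJ, hJ],
      ?_, ?_⟩
    · refine le_trans ?_ hU
      rw [pow_succ, mul_assoc]
      refine Nat.mul_le_mul_left _ ?_
      let A := Finset.univ.filter fun x : Cube n => ∀ h ∈ insert k J, h.fn x = 1
      let B := Finset.univ.filter fun x : Cube n => ∀ h ∈ J, h.fn x = 1
      change 2 * A.card ≤ B.card
      -- Translation by `v` flips `k` and fixes every functional in `J`, so it moves `A` to a
      -- disjoint copy inside `B`.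
      have hdisj : Disjoint A (A.map (addRightEmbedding v)) := by
        rw [Finset.disjoint_left]
        intro x hx hx'
        obtain ⟨y, hy, rfl⟩ := Finset.mem_map.1 hx'
        simp only [A, Finset.mem_filter, Finset.mem_univ, true_and, Finset.forall_mem_insert,
          addRightEmbedding_apply] at hx hy
        have h1 := hx.1
        have h2 := hy.1
        rw [Hyp.fn, dotProduct_add, hkv] at h1
        rw [Hyp.fn] at h2
        rw [add_right_comm, h2] at h1
        exact absurd h1 (by decide)
      have hsub : A ∪ A.map (addRightEmbedding v) ⊆ B := by
        intro x hx
        rw [Finset.mem_union] at hx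
        rcases hx with hx | hx
        · simp only [A, B, Finset.mem_filter, Finset.mem_univ, true_and,
            Finset.forall_mem_insert] at hx ⊢
          exact hx.2
        · obtain ⟨y, hy, rfl⟩ := Finset.mem_map.1 hx
          simp only [A, B, Finset.mem_filter, Finset.mem_univ, true_and,
            Finset.forall_mem_insert, addRightEmbedding_apply] at hy ⊢
          intro h hh
          rw [Hyp.fn, dotProduct_add, hJv h hh, add_zero]
          exact hy.2 h hh
      have := Finset.card_le_card hsub
      rw [Finset.card_union_of_disjoint hdisj, Finset.card_map] at this
      omega
    -- The projection onto the hyperplane `k` along `v`; it preserves each hyperplane in `J`.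
    · let π : Cube n → Cube n := fun x j => x j + v j * k.fn x
      have hπ : IsAffMap π := fun j => (IsAff.coord j).add (k.isAff.const_mul _)
      have hdot : ∀ (a x : Cube n), dotProduct a (π x) = dotProduct a x + dotProduct a v * k.fn x := by
        intro a x
        simp only [π, dotProduct, mul_add, Finset.sum_add_distrib, Finset.sum_mul, mul_assoc]
      have hπk : ∀ x, k.fn (π x) = 0 := by
        intro x
        have : k.fn (π x) = k.fn x + k.fn x := by
          conv_lhs => rw [Hyp.fn, hdot, hkv]
          conv_rhs => lhs; rw [Hyp.fn]
          ring
        rw [this, zmod_two_add_self]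
      have hπJ : ∀ h ∈ J, ∀ x, h.fn (π x) = h.fn x := by
        intro h hh x
        rw [Hyp.fn, hdot, hJv h hh, zero_mul, add_zero, Hyp.fn]
      have hπid : ∀ x, k.fn x = 0 → π x = x := by
        intro x hx
        funext j
        simp [π, hx]
      -- The correction `(g + P k) ∘ π` turns `g` into `P k` on `k`. On a hyperplane of `J` it
      -- vanishes, because there π x lies on both hyperplanes, where `g` and `P k` agree.
      refine ⟨_, hg.add ((hg.add (hP k hkS)).comp hπ), fun h hh x hx => ?_⟩
      rcases Finset.mem_insert.1 hh with rfl | hh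
      · simp only [hπid x hx]
        rw [← add_assoc, zmod_two_add_self, zero_add]
      · have e1 := hgJ h hh (π x) (by rw [hπJ h hh, hx])
        have e2 := hcons h (hJS hh) k hkS (π x) (by rw [hπJ h hh, hx]) (hπk x)
        simp only [e1, e2, zmod_two_add_self, add_zero]
        exact hgJ h hh x hx

/-- If `f` is close to degree `d` on many hyperplanes, then `f` is close to degree `d`. -/
theorem exists_close_of_close_on_hyps {n d : ℕ} (f : BoolFn n) (S : Finset (Hyp n))
    (hS : 8 * 2 ^ d ≤ S.card) (P : Hyp n → BoolFn n) (hP : ∀ h ∈ S, DegLE d (P h))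
    (hclose : ∀ h ∈ S,
      32 * 2 ^ d * (Finset.univ.filter fun x => f x ≠ P h x ∧ h.fn x = 0).card ≤ 2 ^ n) :
    ∃ g : BoolFn n, DegLE d g ∧ 2 ^ d * relDist f g ≤ 1 / 2 := by
  classical
  have hcons : ∀ h ∈ S, ∀ h' ∈ S, ∀ x, h.fn x = 0 → h'.fn x = 0 → P h x = P h' x := by
    intro h hh h' hh'
    by_contra! hcon
    obtain ⟨x, hx, hx', hne⟩ := hcon
    -- Multiplying by the indicators of both hyperplanes gives degree `d + 2`. A disagreement would
    -- then need 2^n / (4 * 2^d) points, but the two error sets together have at most 2^n / (16 *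
    -- 2^d).
    have hdeg := (((hP h hh).add (hP h' hh')).mul (h.isAff.add (IsAff.const 1))).mul
      (h'.isAff.add (IsAff.const 1))
    have h1 := hdeg.two_pow_le ⟨x, by simpa [hx, hx', CharTwo.add_eq_zero] using hne⟩
    have hsub : (fnSupport fun x => (h'.fn x + 1) * ((h.fn x + 1) * (P h x + P h' x))) ⊆
        (Finset.univ.filter fun x => f x ≠ P h x ∧ h.fn x = 0) ∪
        (Finset.univ.filter fun x => f x ≠ P h' x ∧ h'.fn x = 0) := by
      intro y hy
      simp only [mem_fnSupport, Finset.mem_union, Finset.mem_filter, Finset.mem_univ,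
        true_and] at hy ⊢
      revert hy
      generalize f y = z, P h y = p, P h' y = p', h.fn y = l, h'.fn y = l'
      revert z p p' l l'
      decide
    have h2 := (Finset.card_le_card hsub).trans (Finset.card_union_le _ _)
    have h3 := hclose h hh
    have h4 := hclose h' hh'
    have h5 : 0 < 2 ^ n := by positivity
    rw [pow_succ, pow_succ] at h1
    have h6 := Nat.mul_le_mul_left (2 ^ d * 2 * 2) h2
    nlinarith
  have hpd : 1 ≤ 2 ^ d := Nat.one_le_two_pow
  obtain ⟨J, hJS, hJ, hU, g, hg, hgJ⟩ := exists_glue S P hP hcons (d + 2) (by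
    rw [pow_add]; omega)
  have hgS : ∀ h ∈ S, ∀ x, h.fn x = 0 → g x = P h x := by
    intro h hh
    by_contra! hcon
    obtain ⟨x, hx, hne⟩ := hcon
    -- By consistency this product vanishes on every hyperplane of `J`. The at most 2^(n-d-2) points
    -- left are fewer than a nonzero function of degree `d + 1` needs; hence `d + 2` hyperplanes are
    -- glued.
    have hdeg := (hg.add (hP h hh)).mul (h.isAff.add (IsAff.const 1))
    have h1 := hdeg.two_pow_le ⟨x, by simpa [hx, CharTwo.add_eq_zero] using hne⟩
    have hsub : (fnSupport fun x => (h.fn x + 1) * (g x + P h x)) ⊆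
        Finset.univ.filter fun x : Cube n => ∀ h ∈ J, h.fn x = 1 := by
      intro y hy
      simp only [mem_fnSupport, Finset.mem_filter, Finset.mem_univ, true_and] at hy ⊢
      intro k hk
      refine (zmod_two_cases _).resolve_left fun hk0 => hy ?_
      rcases zmod_two_cases (h.fn y) with h0 | h1
      · rw [hgJ k hk y hk0, hcons k (hJS hk) h hh y hk0 h0, zmod_two_add_self, mul_zero]
      · rw [h1, zmod_two_add_self, zero_mul]
    have h2 := Nat.mul_le_mul_left (2 ^ (d + 1)) (Finset.card_le_card hsub)
    have h3 : 2 ^ (d + 2) * (Finset.univ.filter fun x : Cube n => ∀ h ∈ J, h.fn x = 1).card =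
      2 * (2 ^ (d + 1) * (Finset.univ.filter fun x : Cube n => ∀ h ∈ J, h.fn x = 1).card) := by
      ring
    have h5 : 0 < 2 ^ n := by positivity
    rw [h3] at hU
    have h6 := h1.trans h2
    omega
  refine ⟨g, hg, ?_⟩
  have hcard := card_le_of_card_inter_hyp_le S (Finset.univ.filter fun x => f x ≠ g x)
    (2 ^ n / (32 * 2 ^ d)) (by
      intro h hh
      rw [le_div_iff₀ (by positivity), mul_comm, Finset.filter_filter]
      have h1 := hclose h hh
      have h2 : (Finset.univ.filter fun x => f x ≠ g x ∧ h.fn x = 0) =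
          Finset.univ.filter fun x => f x ≠ P h x ∧ h.fn x = 0 := by
        ext x
        simp only [Finset.mem_filter, Finset.mem_univ, true_and]
        exact and_congr_left fun hx => by rw [hgS h hh x hx]
      rw [h2]
      exact_mod_cast h1)
  unfold relDist
  set e : ℝ := ((Finset.univ.filter fun x => f x ≠ g x).card : ℝ)
  have hS' : (8 : ℝ) * 2 ^ d ≤ S.card := by exact_mod_cast hS
  have hpd' : (0 : ℝ) < 2 ^ d := by positivity
  have hpn : (0 : ℝ) < 2 ^ n := by positivity
  have hK : (0 : ℝ) < S.card := by linarith
  rw [mul_div_assoc', div_le_iff₀ hpn]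
  have h1 : (S.card : ℝ) * (2 ^ d * e) ≤ S.card * (1 / 2 * 2 ^ n) := by
    calc (S.card : ℝ) * (2 ^ d * e) = 2 ^ d * (S.card * e) := by ring
      _ ≤ 2 ^ d * (2 ^ n + 4 * S.card * (2 ^ n / (32 * 2 ^ d))) := by gcongr
      _ = 2 ^ d * 2 ^ n + S.card * 2 ^ n / 8 := by field_simp; ring
      _ ≤ _ := by nlinarith
  exact le_of_mul_le_mul_left h1 hK

theorem Hyp.card_ne_le_of_relDist_param_le {n : ℕ} (d : ℕ) (h : Hyp (n + 1))
    (f : BoolFn (n + 1)) (g : BoolFn n)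
    (hfg : 2 ^ d * relDist (fun y => f (h.param y)) g ≤ 1 / 16) :
    32 * 2 ^ d * (Finset.univ.filter fun x => f x ≠ g (h.proj x) ∧ h.fn x = 0).card ≤
      2 ^ (n + 1) := by
  have h2 := h.card_filter_param fun x => f x ≠ g (h.proj x)
  simp only [h.proj_param] at h2
  unfold relDist at hfg
  rw [h2, mul_div_assoc', div_le_iff₀ (by positivity)] at hfg
  have h3 : (32 * 2 ^ d * ((Finset.univ.filter fun x =>
      f x ≠ g (h.proj x) ∧ h.fn x = 0).card : ℝ)) ≤ 2 ^ (n + 1) := by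
    rw [pow_succ]
    linarith
  exact_mod_cast h3

/-- Functions that are not close to degree `d` are rejected with constant probability. -/
theorem flatRej_ge_of_far (d m : ℕ) (f : BoolFn (d + 6 + m))
    (hfar : ∀ g, DegLE d g → 1 / 16 < 2 ^ d * relDist f g) :
    1 / 32 + 1 / 32 / 2 ^ m ≤ flatRej d m f := by
  classical
  induction m with
  | zero =>
    unfold flatRej
    rw [if_neg]
    · norm_num
    · intro hf
      have := hfar f hf
      simp [relDist] at this
      norm_num at this
  | succ m ih =>
    let S : Finset (Hyp (d + 6 + m + 1)) := Finset.univ.filter fun h =>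
      ∃ g, DegLE d g ∧ 2 ^ d * relDist (fun y => f (h.param y)) g ≤ 1 / 16
    have h2m : (1 : ℝ) ≤ 2 ^ m := one_le_pow₀ (by norm_num)
    -- With many good hyperplanes `f` is within the range of the quadratic bound, while its scaled
    -- distance still exceeds 1/16.
    by_cases hS : 8 * 2 ^ d ≤ S.card
    · have hex : ∀ h : Hyp (d + 6 + m + 1), ∃ g, h ∈ S →
          DegLE d g ∧ 2 ^ d * relDist (fun y => f (h.param y)) g ≤ 1 / 16 := by
        intro h
        by_cases hh : h ∈ S
        · obtain ⟨g, hg⟩ := (Finset.mem_filter.1 hh).2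
          exact ⟨g, fun _ => hg⟩
        · exact ⟨0, fun h' => absurd h' hh⟩
      choose G hG using hex
      obtain ⟨g, hg, hgf⟩ := exists_close_of_close_on_hyps f S hS (fun h x => G h (h.proj x))
        (fun h hh => (hG h hh).1.comp h.isAffMap_proj) fun h hh =>
        h.card_ne_le_of_relDist_param_le _ _ _ (hG h hh).2
      refine le_trans ?_ (flatRej_ge_of_close d (m + 1) f g hg hgf)
      refine le_trans ?_ (hfar g hg).le
      have : (1 / 32 / 2 ^ (m + 1) : ℝ) ≤ 1 / 32 :=
        div_le_self (by norm_num) (one_le_pow₀ (by norm_num))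
      linarith
    · unfold flatRej
      -- With few good hyperplanes, discard them and use induction on the rest. The discarded
      -- fraction is O(2^-m), paid for by halving the term `1 / 32 / 2 ^ m`.
      set u : ℝ := 1 / 32 + 1 / 32 / 2 ^ m with hu
      have hpos := card_hyp_succ_pos (d + 6 + m)
      rw [le_div_iff₀ hpos]
      have h1 : ∀ h ∈ (Finset.univ : Finset (Hyp (d + 6 + m + 1))),
          u - (if h ∈ S then u else 0) ≤ flatRej d m fun y => f (h.param y) := by
        intro h _
        by_cases hh : h ∈ S
        · rw [if_pos hh, sub_self]
          exact flatRej_nonneg _ _ _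
        · rw [if_neg hh, sub_zero]
          refine ih _ fun g hg => ?_
          by_contra! hcon
          exact hh (Finset.mem_filter.2 ⟨Finset.mem_univ _, g, hg, hcon⟩)
      refine le_trans ?_ (Finset.sum_le_sum h1)
      rw [Finset.sum_sub_distrib, Finset.sum_const, nsmul_eq_mul, Finset.card_univ,
        ← Finset.sum_filter, Finset.filter_mem_eq_inter, Finset.univ_inter, Finset.sum_const,
        nsmul_eq_mul]
      have hScard : (S.card : ℝ) ≤ 8 * 2 ^ d := by
        push Not at hS
        exact_mod_cast hS.le
      have hH : (Fintype.card (Hyp (d + 6 + m + 1)) : ℝ) = 2 * (64 * 2 * 2 ^ m * 2 ^ d - 1) := by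
        rw [card_hyp, pow_succ, pow_add, pow_add]
        ring
      have hd1 : (1 : ℝ) ≤ 2 ^ d := one_le_pow₀ (by norm_num)
      have hu16 : u ≤ 1 / 16 := by
        have : (1 / 32 / 2 ^ m : ℝ) ≤ 1 / 32 := div_le_self (by norm_num) h2m
        linarith
      have hu0 : 0 ≤ u := by positivity
      have h3 : (S.card : ℝ) * u ≤ 8 * 2 ^ d * (1 / 16) := by gcongr
      have h4 : (1 / 32 / 2 ^ (m + 1) : ℝ) = 1 / 32 / 2 ^ m / 2 := by rw [pow_succ]; field_simp
      have h5 : (64 * 2 ^ m * 2 ^ d : ℝ) ≤ Fintype.card (Hyp (d + 6 + m + 1)) := by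
        rw [hH]
        nlinarith [mul_le_mul h2m hd1 (by norm_num) (by positivity)]
      have h6 : (1 / 32 / 2 ^ m / 2 : ℝ) * (64 * 2 ^ m * 2 ^ d) = 2 ^ d := by field_simp; norm_num
      have h7 : (1 / 32 / 2 ^ m / 2 : ℝ) * (64 * 2 ^ m * 2 ^ d) ≤
          1 / 32 / 2 ^ m / 2 * Fintype.card (Hyp (d + 6 + m + 1)) := by gcongr
      rw [h4, hu]
      rw [hu] at h3
      linarith

/-! ### Operations on algorithms and amplification -/

namespace QueryTree

variable {n k : ℕ}

/-- Relabel the query points. -/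
def map (φ : Cube k → Cube n) : QueryTree k → QueryTree n
  | leaf b => leaf b
  | query x t₀ t₁ => query (φ x) (t₀.map φ) (t₁.map φ)

theorem run_map (φ : Cube k → Cube n) (f : BoolFn n) (t : QueryTree k) :
    (t.map φ).run f = t.run fun x => f (φ x) := by
  induction t with
  | leaf b => rfl
  | query x t₀ t₁ ih₀ ih₁ => simp only [map, run, ih₀, ih₁]

theorem depth_map (φ : Cube k → Cube n) (t : QueryTree k) : (t.map φ).depth = t.depth := by
  induction t with
  | leaf b => rfl
  | query x t₀ t₁ ih₀ ih₁ => simp only [map, depth, ih₀, ih₁]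

/-- Run two algorithms in sequence and accept if both do. -/
def and : QueryTree n → QueryTree n → QueryTree n
  | leaf b, t => if b then t else leaf false
  | query x t₀ t₁, t => query x (t₀.and t) (t₁.and t)

theorem run_and (f : BoolFn n) (s t : QueryTree n) :
    (s.and t).run f = (s.run f && t.run f) := by
  induction s with
  | leaf b => cases b <;> simp [and, run]
  | query x t₀ t₁ ih₀ ih₁ =>
    simp only [and, run]
    split_ifs
    · exact ih₀
    · exact ih₁

theorem depth_and_le (s t : QueryTree n) : (s.and t).depth ≤ s.depth + t.depth := by
  induction s with
  | leaf b => cases b <;> simp [and, depth]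
  | query x t₀ t₁ ih₀ ih₁ =>
    simp only [and, depth]
    omega

/-- Query all points of a list, recording the answers, and decide according to `p`. -/
def queryAll (p : BoolFn n → Bool) : List (Cube n) → BoolFn n → QueryTree n
  | [], g => leaf (p g)
  | x :: l, g => query x (queryAll p l (Function.update g x 0))
      (queryAll p l (Function.update g x 1))

theorem run_queryAll (p : BoolFn n → Bool) (f : BoolFn n) (l : List (Cube n)) (g : BoolFn n)
    (hg : ∀ x, x ∉ l → g x = f x) : (queryAll p l g).run f = p f := by
  induction l generalizing g with
  | nil =>
    have : g = f := funext fun x => hg x (by simp)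
    rw [queryAll, run, this]
  | cons x l ih =>
    have key : ∀ z, f x = z → ∀ y, y ∉ l → Function.update g x z y = f y := by
      intro z hz y hy
      by_cases hyx : y = x
      · rw [hyx, Function.update_self, hz]
      · rw [Function.update_of_ne hyx]
        exact hg y (by simp [hyx, hy])
    rw [queryAll, run]
    rcases zmod_two_cases (f x) with h | h
    · rw [if_pos h, ih _ (key 0 h)]
    · rw [if_neg (by rw [h]; exact one_ne_zero), ih _ (key 1 h)]

theorem depth_queryAll (p : BoolFn n → Bool) (l : List (Cube n)) (g : BoolFn n) :
    (queryAll p l g).depth = l.length := by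
  induction l generalizing g with
  | nil => rfl
  | cons x l ih => simp [queryAll, depth, ih]

/-- Decide membership in `RM(d, n)` by reading the whole function. -/
noncomputable def decideRM (d n : ℕ) : QueryTree n :=
  open Classical in queryAll (fun f => decide (f ∈ RM d n)) Finset.univ.toList 0

theorem run_decideRM (d : ℕ) (f : BoolFn n) :
    (decideRM d n).run f = true ↔ f ∈ RM d n := by
  rw [decideRM, run_queryAll _ f]
  · simp
  · simp

theorem depth_decideRM (d n : ℕ) : (decideRM d n).depth = 2 ^ n := by
  rw [decideRM, depth_queryAll, Finset.length_toList, Finset.card_univ, card_cube]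

end QueryTree

namespace RandAlg

variable {n k : ℕ}

theorem prob_pure (t : QueryTree n) (f : BoolFn n) (b : Bool) :
    RandAlg.prob (PMF.pure t) f b = if t.run f = b then 1 else 0 := by
  rw [prob, PMF.pure_map, PMF.pure_apply]
  by_cases h : t.run f = b
  · rw [if_pos h, if_pos h.symm]
  · rw [if_neg h, if_neg (Ne.symm h)]

theorem prob_map {T : RandAlg k} {φ : QueryTree k → QueryTree n} {f : BoolFn n} {g : BoolFn k}
    (h : ∀ t, (φ t).run f = t.run g) (b : Bool) :
    RandAlg.prob (T.map φ) f b = T.prob g b := by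
  rw [prob, prob, PMF.map_comp]
  congr 2
  exact funext h

theorem prob_bind {α : Type*} (p : PMF α) (T : α → RandAlg n) (f : BoolFn n) (b : Bool) :
    RandAlg.prob (p.bind T) f b = ∑' a, p a * (T a).prob f b := by
  rw [prob, PMF.map_bind, PMF.bind_apply]
  rfl

/-- Repeat a randomized algorithm and accept if all runs accept. -/
noncomputable def rep (T : RandAlg n) : ℕ → RandAlg n
  | 0 => PMF.pure (QueryTree.leaf true)
  | t + 1 => T.bind fun s => (rep T t).map s.and

theorem prob_rep_true (T : RandAlg n) (f : BoolFn n) (t : ℕ) :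
    (T.rep t).prob f true = T.prob f true ^ t := by
  induction t with
  | zero => rw [rep, prob_pure, pow_zero, QueryTree.run, if_pos rfl]
  | succ t ih =>
    rw [rep, prob_bind, pow_succ, mul_comm]
    conv_rhs => lhs; rw [prob_eq_tsum]
    rw [← ENNReal.tsum_mul_right]
    refine tsum_congr fun s => ?_
    by_cases hs : s.run f = true
    · rw [prob_map (g := f), ih, if_pos hs]
      intro t
      rw [QueryTree.run_and, hs, Bool.true_and]
    · rw [if_neg hs, zero_mul, prob_eq_tsum]
      rw [Bool.not_eq_true] at hs
      have h0 : RandAlg.prob ((T.rep t).map s.and) f true = 0 := by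
        rw [prob, PMF.map_comp, PMF.apply_eq_zero_iff, PMF.mem_support_map_iff]
        rintro ⟨u, _, hu⟩
        simp [QueryTree.run_and, hs] at hu
      rw [← prob_eq_tsum, h0, mul_zero]

theorem depth_rep_le {T : RandAlg n} {D : ℕ} (hT : ∀ s ∈ T.support, s.depth ≤ D) (t : ℕ) :
    ∀ s ∈ (T.rep t).support, s.depth ≤ t * D := by
  induction t with
  | zero =>
    intro s hs
    rw [rep, PMF.support_pure, Set.mem_singleton_iff] at hs
    rw [hs]
    simp [QueryTree.depth]
  | succ t ih =>
    intro s hs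
    rw [rep, PMF.mem_support_bind_iff] at hs
    obtain ⟨u, hu, hs⟩ := hs
    rw [PMF.mem_support_map_iff] at hs
    obtain ⟨w, hw, rfl⟩ := hs
    have h1 := QueryTree.depth_and_le u w
    have h2 := hT u hu
    have h3 := ih w hw
    rw [Nat.succ_mul]
    omega

end RandAlg

/-- Amplification of a one-sided test with a small rejection probability `p`. -/
theorem oneSidedTestable_of_rejects {n D t : ℕ} {P : Set (BoolFn n)} {δ p Q : ℝ} (T : RandAlg n)
    (hD : ∀ s ∈ T.support, s.depth ≤ D) (hacc : ∀ f ∈ P, T.prob f false = 0)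
    (hrej : ∀ f, IsFar δ f P → ENNReal.ofReal p ≤ T.prob f false)
    (ht : 2 ≤ p * t) (hQ : (t * D : ℝ) ≤ Q) : OneSidedTestable P δ Q := by
  refine ⟨T.rep t, fun s hs => le_trans ?_ hQ, fun f hf => ?_, fun f hf => ?_⟩
  · exact_mod_cast RandAlg.depth_rep_le hD t s hs
  · have h := T.prob_true_add_prob_false f
    rw [hacc f hf, add_zero] at h
    rw [RandAlg.prob_rep_true, h, one_pow]
  · have h := T.prob_true_add_prob_false f
    have hr := hrej f hf
    have hp : 0 < p := by
      by_contra hp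
      have : p * t ≤ 0 := mul_nonpos_of_nonpos_of_nonneg (not_lt.1 hp) (Nat.cast_nonneg t)
      linarith
    have hp1 : p ≤ 1 := by
      rw [← ENNReal.ofReal_le_one]
      exact hr.trans (le_of_le_of_eq le_add_self h)
    have htrue : T.prob f true ≤ ENNReal.ofReal (1 - p) := by
      rw [ENNReal.ofReal_sub _ hp.le, ENNReal.ofReal_one]
      refine ENNReal.le_sub_of_add_le_right ENNReal.ofReal_ne_top ?_
      rw [← h]
      gcongr
    -- Uses 1 - p ≤ exp(-p) and exp(pt) ≥ 1 + pt ≥ 3.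
    have hpow : (1 - p) ^ t ≤ 1 / 3 := by
      calc (1 - p) ^ t ≤ Real.exp (-p) ^ t :=
            pow_le_pow_left₀ (by linarith) (Real.one_sub_le_exp_neg p) t
        _ = (Real.exp (p * t))⁻¹ := by rw [← Real.exp_nat_mul, ← Real.exp_neg]; ring_nf
        _ ≤ 3⁻¹ := by
          refine inv_anti₀ (by norm_num) ?_
          have := Real.add_one_le_exp (p * t)
          linarith
        _ = 1 / 3 := by norm_num
    have h1 : (T.rep t).prob f true ≤ ENNReal.ofReal (1 / 3) := by
      rw [RandAlg.prob_rep_true]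
      refine (pow_le_pow_left' htrue t).trans ?_
      rw [← ENNReal.ofReal_pow (by linarith)]
      exact ENNReal.ofReal_le_ofReal hpow
    have h2 := (T.rep t).prob_true_add_prob_false f
    by_contra hcon
    push Not at hcon
    have h23 : (2 / 3 : ENNReal) = ENNReal.ofReal (2 / 3) := by
      rw [ENNReal.ofReal_div_of_pos (by norm_num)]; simp
    rw [h23] at hcon
    have h3 := ENNReal.add_lt_add_of_le_of_lt
      (ne_top_of_le_ne_top ENNReal.ofReal_ne_top h1) h1 hcon
    rw [h2, ← ENNReal.ofReal_add (by norm_num) (by norm_num)] at h3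
    norm_num at h3

instance (n : ℕ) : Nonempty (Hyp (n + 1)) :=
  ⟨⟨⟨fun _ => 1, fun h => one_ne_zero (congrFun h 0)⟩, 0⟩⟩

/-! ### The flat test as an algorithm -/

/-- The random flat test for degree at most `d`. -/
noncomputable def flatTest (d : ℕ) : (m : ℕ) → RandAlg (d + 6 + m)
  | 0 => PMF.pure (QueryTree.decideRM d (d + 6))
  | m + 1 => (PMF.uniformOfFintype (Hyp (d + 6 + m + 1))).bind fun h =>
      (flatTest d m).map (QueryTree.map h.param)

theorem depth_flatTest (d m : ℕ) : ∀ s ∈ (flatTest d m).support, s.depth ≤ 2 ^ (d + 6) := by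
  induction m with
  | zero =>
    intro s hs
    rw [flatTest, PMF.support_pure, Set.mem_singleton_iff] at hs
    rw [hs]
    exact (QueryTree.depth_decideRM d (d + 6)).le
  | succ m ih =>
    intro s hs
    rw [flatTest, PMF.mem_support_bind_iff] at hs
    obtain ⟨h, _, hs⟩ := hs
    rw [PMF.mem_support_map_iff] at hs
    obtain ⟨w, hw, rfl⟩ := hs
    rw [QueryTree.depth_map]
    exact ih w hw

theorem prob_flatTest_false (d m : ℕ) (f : BoolFn (d + 6 + m)) :
    (flatTest d m).prob f false = ENNReal.ofReal (flatRej d m f) := by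
  induction m with
  | zero =>
    rw [flatTest, flatRej, RandAlg.prob_pure]
    have h := QueryTree.run_decideRM d (n := d + 6) f
    rw [mem_RM_iff] at h
    by_cases hf : DegLE d f
    · rw [if_pos hf, if_neg, ENNReal.ofReal_zero]
      rw [Bool.not_eq_false]
      exact h.2 hf
    · rw [if_neg hf, if_pos, ENNReal.ofReal_one]
      rw [← Bool.not_eq_true]
      exact fun hr => hf (h.1 hr)
  | succ m ih =>
    rw [flatTest, flatRej, RandAlg.prob_bind, tsum_fintype,
      ENNReal.ofReal_div_of_pos (card_hyp_succ_pos _),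
      ENNReal.ofReal_sum_of_nonneg fun h _ => flatRej_nonneg _ _ _, div_eq_mul_inv, mul_comm,
      Finset.mul_sum, ENNReal.ofReal_natCast]
    refine Finset.sum_congr rfl fun h _ => ?_
    rw [PMF.uniformOfFintype_apply, ← ih,
      RandAlg.prob_map (g := fun y => f (h.param y)) fun t => t.run_map h.param f]

theorem flatRej_eq_zero {d m : ℕ} {f : BoolFn (d + 6 + m)} (hf : DegLE d f) :
    flatRej d m f = 0 := by
  induction m with
  | zero => rw [flatRej, if_pos hf]
  | succ m ih =>
    rw [flatRej, Finset.sum_eq_zero fun h _ => ih (hf.comp h.isAffMap_param), zero_div]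

/-- The regimes overlap: the quadratic bound works up to scaled distance 1/2, the inductive one from
1/16 on. -/
theorem flatRej_ge_min {d m : ℕ} {f : BoolFn (d + 6 + m)} {δ : ℝ}
    (hf : IsFar δ f (RM d (d + 6 + m))) : min (2 ^ d * δ) (1 / 32) ≤ flatRej d m f := by
  by_cases h : ∃ g, DegLE d g ∧ 2 ^ d * relDist f g ≤ 1 / 2
  · obtain ⟨g, hg, hfg⟩ := h
    refine (min_le_left _ _).trans (le_trans ?_ (flatRej_ge_of_close d m f g hg hfg))
    have := hf g (mem_RM_iff.2 hg)
    gcongr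
  · push Not at h
    refine (min_le_right _ _).trans (le_trans ?_ (flatRej_ge_of_far d m f fun g hg => ?_))
    · have : (0 : ℝ) ≤ 1 / 32 / 2 ^ m := by positivity
      linarith
    · have := h g hg
      linarith

/-- Reed-Muller codes are testable with `O(2 ^ d + 1 / δ)` queries. -/
theorem oneSidedTestable_RM (d n : ℕ) {δ : ℝ} (hδ : 0 < δ) :
    OneSidedTestable (RM d n) δ (4160 * 2 ^ d + 128 / δ) := by
  have h2d : (0 : ℝ) < 2 ^ d := by positivity
  rcases le_total n (d + 6) with hn | hn
  -- In small dimension the whole function is read; `t = 2` only meets the amplification requirement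
  -- 2 ≤ p t.
  · refine oneSidedTestable_of_rejects (D := 2 ^ n) (t := 2) (p := 1)
      (PMF.pure (QueryTree.decideRM d n)) ?_ ?_ ?_ (by norm_num) ?_
    · intro s hs
      rw [PMF.support_pure, Set.mem_singleton_iff] at hs
      rw [hs, QueryTree.depth_decideRM]
    · intro f hf
      rw [RandAlg.prob_pure, (QueryTree.run_decideRM d f).2 hf]
      simp
    · intro f hf
      have : f ∉ RM d n := by
        intro hmem
        have := hf f hmem
        simp [relDist] at this
        linarith
      rw [← QueryTree.run_decideRM, Bool.not_eq_true] at this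
      rw [RandAlg.prob_pure, this]
      simp
    · have h1 : (2 : ℝ) ^ n ≤ 2 ^ (d + 6) := pow_le_pow_right₀ (by norm_num) hn
      rw [pow_add] at h1
      have h2 : 0 ≤ 128 / δ := by positivity
      push_cast
      linarith
  · obtain ⟨m, rfl⟩ := Nat.exists_eq_add_of_le hn
    set p : ℝ := min (2 ^ d * δ) (1 / 32) with hp
    have hp0 : 0 < p := lt_min (by positivity) (by norm_num)
    refine oneSidedTestable_of_rejects (D := 2 ^ (d + 6)) (t := ⌈2 / p⌉₊) (p := p)
      (flatTest d m) (depth_flatTest d m) ?_ ?_ ?_ ?_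
    · intro f hf
      rw [prob_flatTest_false, flatRej_eq_zero (mem_RM_iff.1 hf), ENNReal.ofReal_zero]
    · intro f hf
      rw [prob_flatTest_false]
      exact ENNReal.ofReal_le_ofReal (flatRej_ge_min hf)
    · have := Nat.le_ceil (2 / p)
      rwa [div_le_iff₀ hp0, mul_comm] at this
    · have h1 : (⌈2 / p⌉₊ : ℝ) ≤ 2 / p + 1 := (Nat.ceil_lt_add_one (by positivity)).le
      have h2 : 2 / p ≤ 2 / (2 ^ d * δ) + 64 := by
        have h3 : 0 < 2 / (2 ^ d * δ) := by positivity
        rcases min_choice (2 ^ d * δ) (1 / 32) with h | h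
        · rw [hp, h]; linarith
        · rw [hp, h, show (2 : ℝ) / (1 / 32) = 64 by norm_num]; linarith
      have h4 : (⌈2 / p⌉₊ : ℝ) ≤ 2 / (2 ^ d * δ) + 65 := by linarith
      -- The constants are 4160 = 65 * 64 and 128 = 2 * 64, with 64 from the six extra dimensions.
      calc (⌈2 / p⌉₊ : ℝ) * ((2 ^ (d + 6) : ℕ) : ℝ)
          ≤ (2 / (2 ^ d * δ) + 65) * ((2 ^ (d + 6) : ℕ) : ℝ) := by gcongr
        _ = 4160 * 2 ^ d + 128 / δ := by
          push_cast
          rw [pow_add]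
          field_simp
          ring

/-! ### Choice of the degree and the main theorem -/

theorem two_pow_clog_le {q : ℕ} (hq : 1 ≤ q) : 2 ^ Nat.clog 2 q ≤ 2 * q := by
  rcases hq.eq_or_lt with rfl | h1
  · simp
  · have h2 := Nat.pow_pred_clog_lt_self (b := 2) (by norm_num) h1
    have h3 : 0 < Nat.clog 2 q := Nat.clog_pos (by norm_num) h1
    rw [← Nat.succ_pred_eq_of_pos h3, pow_succ]
    omega

/-- Fewer than `q` queries are eventually at most `2 ^ ⌈log₂ q⌉`. -/
theorem eventually_le_two_pow_clog {q : ℕ → ℕ} {Q : ℕ → ℝ}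
    (hQ : Q =o[atTop] fun n => (q n : ℝ)) : ∀ᶠ n in atTop, Q n ≤ 2 ^ Nat.clog 2 (q n) := by
  filter_upwards [hQ.bound one_pos] with n hn
  rw [one_mul, Real.norm_natCast] at hn
  have h : (q n : ℝ) ≤ 2 ^ Nat.clog 2 (q n) := by
    exact_mod_cast Nat.le_pow_clog (by norm_num) (q n)
  exact (le_abs_self _).trans (hn.trans h)

theorem eventually_two_mul_clog_le {q : ℕ → ℕ}
    (hq : (fun n => (q n : ℝ)) =O[atTop] fun n : ℕ => (2 : ℝ) ^ ((n : ℝ) / 2)) :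
    ∃ c : ℕ, ∀ᶠ n in atTop, 2 * Nat.clog 2 (q n) ≤ n + 2 * c := by
  obtain ⟨K, hK⟩ := hq.bound
  obtain ⟨c, hc⟩ := pow_unbounded_of_one_lt K (show (1 : ℝ) < 2 by norm_num)
  refine ⟨c + 1, ?_⟩
  filter_upwards [hK] with n hn
  have h1 : Nat.clog 2 (q n) ≤ c + (n + 1) / 2 := by
    refine Nat.clog_le_of_le_pow ?_
    have hpow : (2 : ℝ) ^ ((n : ℝ) / 2) ≤ 2 ^ ((n + 1) / 2) := by
      rw [← Real.rpow_natCast]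
      refine Real.rpow_le_rpow_of_exponent_le (by norm_num) ?_
      rw [div_le_iff₀ (by norm_num)]
      exact_mod_cast (show n ≤ (n + 1) / 2 * 2 by omega)
    have hpos : (0 : ℝ) < (2 : ℝ) ^ ((n : ℝ) / 2) := by positivity
    rw [Real.norm_natCast, Real.norm_of_nonneg hpos.le] at hn
    have : (q n : ℝ) ≤ 2 ^ (c + (n + 1) / 2) := by
      rw [pow_add]
      exact hn.trans (mul_le_mul hc.le hpow hpos.le (by positivity))
    exact_mod_cast this
  omega

theorem mainTheorem4 :
    ∃ C : ℝ, 0 < C ∧ ∃ δ₀ : ℝ, 0 < δ₀ ∧ δ₀ ≤ 1 ∧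
      ∀ q : ℕ → ℕ, (∀ n, 1 ≤ q n) →
        -- the property is affine-invariant
        (∀ n, AffineInvariant (RMHier q n)) ∧
        -- it is testable with `O(q(n))` queries and one-sided error
        (∀ (n : ℕ) (δ : ℝ), 0 < δ → δ ≤ 1 →
          OneSidedTestable (RMHier q n) δ (C * (q n + 1 / δ))) ∧
        -- constant proximity parameter: not testable with `o(q(n))` queries
        ((fun n => (q n : ℝ)) =O[atTop] (fun n : ℕ => (2 : ℝ) ^ ((n : ℝ) / 2)) →
          ∀ Q : ℕ → ℝ, Q =o[atTop] (fun n => (q n : ℝ)) →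
            ∀ᶠ n in atTop, ¬ TwoSidedTestable (RMHier q n) δ₀ (Q n)) ∧
        -- all `q` up to half the domain size: not testable with `o(q(n))` queries
        ((∀ᶠ n in atTop, (q n : ℝ) ≤ 2 ^ n / 2) →
          ∀ Q : ℕ → ℝ, Q =o[atTop] (fun n => (q n : ℝ)) →
            ∀ᶠ n in atTop, ¬ TwoSidedTestable (RMHier q n) (1 / (4 * q n)) (Q n)) := by
  refine ⟨8320, by norm_num, 1 / 64, by norm_num, by norm_num, fun q hq =>
    ⟨fun n => affineInvariant_RM _ n, fun n δ hδ _ => ?_, fun hO Q hQ => ?_, fun hle Q hQ => ?_⟩⟩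
  · obtain ⟨T, hT, h⟩ := oneSidedTestable_RM (Nat.clog 2 (q n)) n hδ
    refine ⟨T, fun t ht => (hT t ht).trans ?_, h⟩
    have h1 : (2 : ℝ) ^ Nat.clog 2 (q n) ≤ 2 * q n := by exact_mod_cast two_pow_clog_le (hq n)
    have h2 : 128 / δ = 128 * (1 / δ) := by ring
    have h3 : 0 < 1 / δ := by positivity
    rw [h2]
    linarith
  · obtain ⟨c, hc⟩ := eventually_two_mul_clog_le hO
    filter_upwards [hc, eventually_le_two_pow_clog hQ,
      eventually_ge_atTop (64 * (2 * c + 1) ^ 2)] with n h1 h2 h3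
    obtain ⟨h, hh⟩ := exists_isFar_const h1 h3
    exact not_twoSidedTestable_RM h2 hh
  · filter_upwards [hle, eventually_le_two_pow_clog hQ, eventually_ge_atTop 1] with n h1 h2 h3
    have hd : Nat.clog 2 (q n) + 1 ≤ n := by
      obtain ⟨m, rfl⟩ := Nat.exists_eq_add_of_le' h3
      rw [pow_succ, mul_div_cancel_right₀ _ (by norm_num)] at h1
      have : Nat.clog 2 (q (m + 1)) ≤ m := Nat.clog_le_of_le_pow (by exact_mod_cast h1)
      omega
    obtain ⟨h, hh⟩ := exists_isFar_two_pow hd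
    refine not_twoSidedTestable_RM h2 (h := h) fun g hg => le_trans ?_ (hh g hg)
    -- Rounding the logarithm up costs a factor 2 and the degree `d + 1` another, whence the
    -- proximity parameter 1/(4q).
    have h4 : (2 : ℝ) ^ Nat.clog 2 (q n) ≤ 2 * q n := by exact_mod_cast two_pow_clog_le (hq n)
    refine one_div_le_one_div_of_le (by positivity) ?_
    rw [pow_succ]
    linarith
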